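/- Let $N\ge 2$, let $x_0\in\mathbb H^N$ be a fixed pole in the $N$-dimensional hyperbolic space, $r=d(x,x_0)$ the geodesic distance to the pole, and $(r,\sigma)\in(0,\infty)\times\mathbb S^{N-1}$ geodesic polar coordinates around $x_0$. Let $0<R\le\infty$, let $B_R=\{x: d(x,x_0)<R\}$, and let $V=V(r)$ be a real-valued, locally integrable radial weight on $(0,R)$. For $u\in C_c^\infty(B_R\setminus\{x_0\})$ (real-valued) and $n\ge 0$ let $u_n(r,\cdot)$ be the component of order $n$ of $u$, i.e. the $L^2(\mathbb S^{N-1})$-orthogonal projection of $u(r,\cdot)$ onto the spherical harmonics of order $n$ (the restrictions to $\mathbb S^{N-1}$ of the homogeneous harmonic polynomials of degree $n$). For an integer $j\ge -1$ let $$\mathcal H_j(B_R\setminus\{x_0\})=\{u\in C_c^\infty(B_R\setminus\{x_0\}) : u_n=0 \text{ for } 0\le n\le j\}.$$ Then for all $u\in\mathcal H_j(B_R\setminus\{x_0\})$ all the integrals below converge absolutely, the series converges, and $$\int_{B_R}V(r)|\nabla_{\mathbb H^N}u|^2\,dv_{\mathbb H^N}-\int_{B_R}V(r)\Big(\frac{\partial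 u}{\partial r}\Big)^2dv_{\mathbb H^N}=(j+1)(N+j-1)\int_{B_R}\frac{V(r)\,u^2}{\sinh^2 r}\,dv_{\mathbb H^N}+\sum_{n=j+1}^{\infty}(n-j-1)(N+n+j-1)\int_0^R V(r)\,\|u_n(r,\cdot)\|_{L^2(\mathbb S^{N-1})}^2\,(\sinh r)^{N-3}\,dr .$$ In particular, if $V\ge 0$ on $(0,R)$, then $$\int_{B_R}V(r)|\nabla_{\mathbb H^N}u|^2\,dv_{\mathbb H^N}-\int_{B_R}V(r)\Big(\frac{\partial u}{\partial r}\Big)^2dv_{\mathbb H^N}\ \ge\ (j+1)(N+j-1)\int_{B_R}\frac{V(r)\,u^2}{\sinh^2 r}\,dv_{\mathbb H^N}.$$ -/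

import Mathlib

open MeasureTheory Metric Set
open scoped ENNReal ContDiff RealInnerProductSpace

noncomputable section

namespace Hyp

/-- The Euclidean space `ℝ^N`. It is used both as the range of a global chart of hyperbolic space
and as the ambient space of the unit sphere `S^{N-1}`. -/
abbrev E (N : ℕ) : Type := EuclideanSpace ℝ (Fin N)

/-! ### Hyperbolic space

`ℍ^N` is the hyperboloid `{(x, t) ∈ ℝ^N × ℝ : t² - |x|² = 1, t > 0}` with the Riemannian metric
induced by the Minkowski form `|dx|² - dt²`. It is described in the global chart `(x, t) ↦ x`, so a
point of `ℍ^N` is a vector `x ∈ ℝ^N`, which stands for `(x, √(1 + |x|²))`. The chart is a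
diffeomorphism onto `ℝ^N`, so smooth functions on `ℍ^N` are smooth functions on `ℝ^N`. -/

/-- The last coordinate `t = √(1 + |x|²)` of the point of the hyperboloid above `x`. -/
def height {N : ℕ} (x : E N) : ℝ := Real.sqrt (1 + ‖x‖ ^ 2)

/-- The hyperbolic metric at `x`: the Minkowski form on the tangent vectors
`(v, ⟪x, v⟫ / t)` and `(w, ⟪x, w⟫ / t)`. -/
def metric {N : ℕ} (x v w : E N) : ℝ :=
  ⟪v, w⟫ - (⟪x, v⟫ / height x) * (⟪x, w⟫ / height x)

/-- The geodesic distance of `ℍ^N`: `cosh d(x, y)` is minus the Minkowski product. -/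
def hdist {N : ℕ} (x y : E N) : ℝ := Real.arcosh (height x * height y - ⟪x, y⟫)

/-- The Riemannian gradient: the vector field representing `du` in the metric
(see `metric_grad`). -/
def grad {N : ℕ} (u : E N → ℝ) (x : E N) : E N :=
  gradient u x + ⟪x, gradient u x⟫ • x

/-- `|∇u|²`, with the length measured in the hyperbolic metric. -/
def gradSq {N : ℕ} (u : E N → ℝ) (x : E N) : ℝ := metric x (grad u x) (grad u x)

/-- The Riemannian volume measure: `√(det g) dx = dx / √(1 + |x|²)`
(see `inv_height_eq_sqrt_det`). -/
def vol (N : ℕ) : Measure (E N) :=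
  (volume : Measure (E N)).withDensity fun x => ENNReal.ofReal (height x)⁻¹

/-- The open geodesic ball `B_R` around the pole, `0 < R ≤ ∞`. -/
def hball {N : ℕ} (x₀ : E N) (R : ℝ≥0∞) : Set (E N) :=
  {x | ENNReal.ofReal (hdist x₀ x) < R}

/-- The interval `(0, R)`, `0 < R ≤ ∞`. -/
def radii (R : ℝ≥0∞) : Set ℝ := {r | 0 < r ∧ ENNReal.ofReal r < R}

/-! ### Geodesic polar coordinates around a pole -/

/-- A linear isometry from `ℝ^N` with the Euclidean inner product onto the tangent space at the
pole `x₀` with the hyperbolic metric (see `metric_frame`). It identifies `S^{N-1}` with the unit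
sphere of the tangent space. -/
def frame {N : ℕ} (x₀ σ : E N) : E N := σ + (⟪x₀, σ⟫ / (1 + height x₀)) • x₀

/-- Geodesic polar coordinates: `(r, σ)` is sent to the point at time `r` on the unit speed
geodesic that leaves the pole `x₀` in the direction `σ`. -/
def polar {N : ℕ} (x₀ : E N) (r : ℝ) (σ : E N) : E N :=
  Real.cosh r • x₀ + Real.sinh r • frame x₀ σ

/-- The unit vector field `∂/∂r` of geodesic polar coordinates at `x ≠ x₀`
(see `hasDerivAt_polar` and `hasDerivAt_comp_polar`). -/
def radialDir {N : ℕ} (x₀ x : E N) : E N :=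
  (Real.sinh (hdist x₀ x))⁻¹ • (Real.cosh (hdist x₀ x) • x - x₀)

/-- The radial derivative `∂u/∂r`. -/
def radialDeriv {N : ℕ} (x₀ : E N) (u : E N → ℝ) (x : E N) : ℝ :=
  fderiv ℝ u x (radialDir x₀ x)

/-! ### Spherical harmonics -/

/-- The surface measure on the unit sphere `S^{N-1}`. -/
abbrev sphereMeasure (N : ℕ) : Measure (sphere (0 : E N) 1) := (volume : Measure (E N)).toSphere

/-- The Laplacian on polynomials in `N` variables. -/
def polyLaplacian (N : ℕ) : MvPolynomial (Fin N) ℝ →ₗ[ℝ] MvPolynomial (Fin N) ℝ :=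
  ∑ i : Fin N, (MvPolynomial.pderiv i).toLinearMap ∘ₗ (MvPolynomial.pderiv i).toLinearMap

/-- Homogeneous harmonic polynomials of degree `n`. -/
def harmonicPoly (N n : ℕ) : Submodule ℝ (MvPolynomial (Fin N) ℝ) :=
  MvPolynomial.homogeneousSubmodule (Fin N) ℝ n ⊓ LinearMap.ker (polyLaplacian N)

/-- Restriction of a polynomial to the unit sphere. -/
def restrictSphere (N : ℕ) : MvPolynomial (Fin N) ℝ →ₗ[ℝ] C(sphere (0 : E N) 1, ℝ) where
  toFun P := ⟨fun σ => MvPolynomial.eval (fun i => (σ : E N) i) P, by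
    refine (MvPolynomial.continuous_eval P).comp ?_
    fun_prop⟩
  map_add' P Q := by ext σ; simp
  map_smul' c P := by ext σ; simp [MvPolynomial.smul_eval]

/-- The space of spherical harmonics of order `n`, as a subspace of `L²(S^{N-1})`. -/
def sphericalHarmonics (N n : ℕ) : Submodule ℝ (Lp ℝ 2 (sphereMeasure N)) :=
  (harmonicPoly N n).map
    ((ContinuousMap.toLp (E := ℝ) 2 (sphereMeasure N) ℝ).toLinearMap ∘ₗ restrictSphere N)

instance (N n : ℕ) : FiniteDimensional ℝ (sphericalHarmonics N n) := by
  have h : FiniteDimensional ℝ (MvPolynomial.homogeneousSubmodule (Fin N) ℝ n) :=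
    Module.Finite.iff_fg.mpr (MvPolynomial.homogeneousSubmodule_fg (Fin N) ℝ n)
  have h' : FiniteDimensional ℝ (harmonicPoly N n) :=
    Submodule.finiteDimensional_of_le inf_le_left
  unfold sphericalHarmonics
  infer_instance

open Classical in
/-- The function `σ ↦ u(r, σ)` on `S^{N-1}`, as an element of `L²(S^{N-1})`. -/
def slice {N : ℕ} (x₀ : E N) (u : E N → ℝ) (r : ℝ) : Lp ℝ 2 (sphereMeasure N) :=
  if h : MemLp (fun σ : sphere (0 : E N) 1 => u (polar x₀ r σ)) 2 (sphereMeasure N)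
  then h.toLp else 0

/-- The component `u_n(r, ·)` of order `n` in the decomposition `u(r, ·) = ∑ u_n(r, ·)` into
spherical harmonics: the orthogonal projection in `L²(S^{N-1})` of `u(r, ·)` to the spherical
harmonics of order `n`. -/
def component {N : ℕ} (x₀ : E N) (u : E N → ℝ) (n : ℕ) (r : ℝ) : Lp ℝ 2 (sphereMeasure N) :=
  (sphericalHarmonics N n).starProjection (slice x₀ u r)

/-- Smooth real functions with compact support contained in `Ω`. -/
def testFunctions {N : ℕ} (Ω : Set (E N)) : Set (E N → ℝ) :=
  {u | ContDiff ℝ ∞ u ∧ HasCompactSupport u ∧ tsupport u ⊆ Ω}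

/-- The space `H_j(Ω)` of test functions on `Ω` with `u_0 = ⋯ = u_j = 0`, for `j ≥ -1`. For
`j = -1` there is no condition. -/
def subspaceH {N : ℕ} (x₀ : E N) (j : ℤ) (Ω : Set (E N)) : Set (E N → ℝ) :=
  {u | u ∈ testFunctions Ω ∧
    ∀ n : ℕ, (n : ℤ) ≤ j → ∀ r : ℝ, 0 < r → component x₀ u n r = 0}

/-! ### Checks of the explicit formulas -/

theorem height_sq {N : ℕ} (x : E N) : height x ^ 2 = 1 + ‖x‖ ^ 2 :=
  Real.sq_sqrt (by positivity)

theorem height_pos {N : ℕ} (x : E N) : 0 < height x := Real.sqrt_pos.mpr (by positivity)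

theorem metric_grad {N : ℕ} (u : E N → ℝ) (x w : E N) :
    metric x (grad u x) w = fderiv ℝ u x w := by
  have h : ⟪gradient u x, w⟫ = fderiv ℝ u x w := by simp [gradient]
  have hh := height_sq x
  have hp := (height_pos x).ne'
  rw [← h]
  simp only [metric, grad, inner_add_left, inner_add_right, inner_smul_left, inner_smul_right,
    real_inner_self_eq_norm_sq]
  field_simp
  simp
  have : ‖x‖ ^ 2 = height x ^ 2 - 1 := by linarith
  rw [this]; ring

theorem metric_frame {N : ℕ} (x₀ σ τ : E N) :
    metric x₀ (frame x₀ σ) (frame x₀ τ) = ⟪σ, τ⟫ := by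
  have hh := height_sq x₀
  have hp := height_pos x₀
  have : ‖x₀‖ ^ 2 = height x₀ ^ 2 - 1 := by linarith
  simp only [metric, frame, inner_add_left, inner_add_right, inner_smul_left, inner_smul_right,
    real_inner_self_eq_norm_sq, this, real_inner_comm x₀ σ]
  simp
  field_simp
  ring

theorem inv_height_eq_sqrt_det {N : ℕ} (x : E N) :
    (height x)⁻¹ = Real.sqrt (Matrix.det (Matrix.of fun i j : Fin N =>
      metric x (EuclideanSpace.single i 1) (EuclideanSpace.single j 1))) := by
  have hp := height_pos x
  have hM : (Matrix.of fun i j : Fin N =>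
      metric x (EuclideanSpace.single i 1) (EuclideanSpace.single j 1)) =
      1 + Matrix.replicateCol Unit (fun i => -(x i / height x)) *
        Matrix.replicateRow Unit (fun i => x i / height x) := by
    ext i j
    by_cases h : i = j <;>
      simp [metric, EuclideanSpace.inner_single_right, Matrix.mul_apply, h,
        sub_eq_add_neg, eq_comm]
  have hd : (fun i => x i / height x) ⬝ᵥ (fun i => -(x i / height x)) =
      -(‖x‖ ^ 2 / height x ^ 2) := by
    simp only [dotProduct, EuclideanSpace.norm_sq_eq, Real.norm_eq_abs, sq_abs, Finset.sum_div,
      ← Finset.sum_neg_distrib]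
    exact Finset.sum_congr rfl fun i _ => by ring
  rw [hM, Matrix.det_one_add_replicateCol_mul_replicateRow, hd]
  have : 1 + -(‖x‖ ^ 2 / height x ^ 2) = (height x)⁻¹ ^ 2 := by
    have := height_sq x
    field_simp
    linarith
  rw [this, Real.sqrt_sq (by positivity)]

theorem height_polar {N : ℕ} (x₀ : E N) (r : ℝ) (σ : sphere (0 : E N) 1) :
    height (polar x₀ r σ) = Real.cosh r * height x₀ + Real.sinh r * ⟪x₀, (σ : E N)⟫ := by
  have hp := height_pos x₀
  have hh := height_sq x₀
  have hx : ‖x₀‖ ^ 2 = height x₀ ^ 2 - 1 := by linarith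
  have hσ : ‖(σ : E N)‖ = 1 := norm_eq_of_mem_sphere σ
  have hc := Real.cosh_sq r
  have hcs := abs_real_inner_le_norm x₀ (σ : E N)
  rw [hσ, mul_one] at hcs
  have hs : |⟪x₀, (σ : E N)⟫| ≤ height x₀ :=
    hcs.trans (Real.le_sqrt_of_sq_le (by linarith))
  have hsc : |Real.sinh r| ≤ Real.cosh r :=
    abs_le_of_sq_le_sq (by linarith) (Real.cosh_pos r).le
  have hnn : 0 ≤ Real.cosh r * height x₀ + Real.sinh r * ⟪x₀, (σ : E N)⟫ := by
    have h1 := mul_le_mul hsc hs (abs_nonneg _) (Real.cosh_pos r).le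
    rw [← abs_mul] at h1
    linarith [neg_abs_le (Real.sinh r * ⟪x₀, (σ : E N)⟫)]
  rw [height, Real.sqrt_eq_iff_mul_self_eq (by positivity) hnn, ← real_inner_self_eq_norm_sq]
  simp only [polar, frame, inner_add_left, inner_add_right, inner_smul_left, inner_smul_right,
    real_inner_self_eq_norm_sq, hx, hσ, real_inner_comm x₀ (σ : E N)]
  simp
  field_simp
  linear_combination (-(1 + height x₀) ^ 2) * hc

theorem hdist_polar {N : ℕ} (x₀ : E N) {r : ℝ} (hr : 0 ≤ r) (σ : sphere (0 : E N) 1) :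
    hdist x₀ (polar x₀ r σ) = r := by
  have hp := height_pos x₀
  have hh := height_sq x₀
  have hx : ‖x₀‖ ^ 2 = height x₀ ^ 2 - 1 := by linarith
  have h : height x₀ * height (polar x₀ r σ) - ⟪x₀, polar x₀ r σ⟫ = Real.cosh r := by
    rw [height_polar]
    simp only [polar, frame, inner_add_right, inner_smul_right, real_inner_self_eq_norm_sq, hx]
    field_simp
    ring
  rw [hdist, h, Real.arcosh_cosh hr]

theorem hasDerivAt_polar {N : ℕ} (x₀ : E N) {r : ℝ} (hr : 0 < r) (σ : sphere (0 : E N) 1) :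
    HasDerivAt (fun s => polar x₀ s (σ : E N)) (radialDir x₀ (polar x₀ r σ)) r := by
  have hs : Real.sinh r ≠ 0 := (Real.sinh_pos_iff.mpr hr).ne'
  have h := ((Real.hasDerivAt_cosh r).smul_const x₀).add
    ((Real.hasDerivAt_sinh r).smul_const (frame x₀ (σ : E N)))
  refine h.congr_deriv (Eq.symm ?_)
  rw [radialDir, hdist_polar x₀ hr.le, polar, inv_smul_eq_iff₀ hs]
  have hc := Real.cosh_sq r
  have : Real.cosh r * Real.cosh r = Real.sinh r * Real.sinh r + 1 := by linarith
  simp only [smul_add, smul_smul, this, add_smul, one_smul, mul_comm (Real.cosh r) (Real.sinh r)]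
  abel

theorem hasDerivAt_comp_polar {N : ℕ} (x₀ : E N) {u : E N → ℝ} (hu : Differentiable ℝ u) {r : ℝ}
    (hr : 0 < r) (σ : sphere (0 : E N) 1) :
    HasDerivAt (fun s => u (polar x₀ s (σ : E N))) (radialDeriv x₀ u (polar x₀ r σ)) r :=
  (hu _).hasFDerivAt.comp_hasDerivAt r (hasDerivAt_polar x₀ hr σ)

end Hyp

end

/-!
The proof separates variables in geodesic polar coordinates. Two facts carry it.

*Geometry.* At the point `polar x₀ r σ` the squared gradient is the squared radial derivative plus
`(sinh r)⁻²` times the squared gradient along the unit sphere of the slice `u(r, ·)`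
(`gradSq_polar`), and the volume is `(sinh r)^(N-1) dr dσ` (`measurePreserving_polar`). The latter
follows from Euclidean polar coordinates at the origin, since a Lorentz boost is a diffeomorphism
that preserves the volume and moves the origin to the pole (`lintegral_vol_comp_boost`).

*Harmonic analysis on the sphere.* For a smooth `w` with components `w_n`,
`∫ |∇w|² = ∑ n (n + N - 2) ‖w_n‖²` (`hasSum_sphereEigenvalue_mul_norm_sq`). No manifold structure on
the sphere is used: functions on the sphere are restrictions of functions on `ℝ^N`, the spherical
gradient and Laplacian are built from the infinitesimal rotations `xᵢ ∂ₖ - xₖ ∂ᵢ`, and rotation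
invariance of the surface measure gives integration by parts (`integral_rot_mul`). A harmonic
homogeneous polynomial is an eigenvector of the spherical Laplacian (`sum_rotPoly_rotPoly`), so the
spaces of spherical harmonics are orthogonal; they span a dense subspace because every polynomial
agrees on the sphere with a sum of harmonic ones (`exists_harmonicPoly_add_normSqPoly_mul`) and
polynomials are dense by the Stone–Weierstrass theorem. The formula for the Dirichlet integral is
then Parseval's identity for `w` and its spherical Laplacian.

With `c = (j + 1)(N + j - 1)`, the eigenvalue of order `j + 1`, the identity on a single slice is
`∫ |∇w|² - c ∫ w² = ∑ (n - j - 1)(N + n + j - 1) ‖w_n‖²` (`hasSum_slice`). All coefficients with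
`n ≥ j + 1` are nonnegative, so after multiplication by `V(r) (sinh r)^(N-3)` the terms at a given
radius have one sign, and dominated convergence allows integrating the series term by term in `r`.
-/

noncomputable section

namespace Hyp

/-! ### Harmonic polynomials -/

section Polynomials

open MvPolynomial

/-- The polynomial `|x|² = ∑ xᵢ²`. -/
def normSqPoly (N : ℕ) : MvPolynomial (Fin N) ℝ := ∑ i, X i ^ 2

/-- The infinitesimal rotation `xᵢ ∂ₖ - xₖ ∂ᵢ` on polynomials. -/
def rotPoly {N : ℕ} (i k : Fin N) (P : MvPolynomial (Fin N) ℝ) : MvPolynomial (Fin N) ℝ :=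
  X i * pderiv k P - X k * pderiv i P

/-- The eigenvalue `n (n + N - 2)` of the Laplacian of `S^{N-1}` on spherical harmonics of
order `n`, up to sign. -/
def sphereEigenvalue (N n : ℕ) : ℝ := n * (n + N - 2)

theorem polyLaplacian_apply {N : ℕ} (P : MvPolynomial (Fin N) ℝ) :
    polyLaplacian N P = ∑ i, pderiv i (pderiv i P) := by
  simp [polyLaplacian]

theorem isHomogeneous_normSqPoly (N : ℕ) : (normSqPoly N).IsHomogeneous 2 :=
  IsHomogeneous.sum _ _ _ fun i _ => isHomogeneous_X_pow i 2

theorem isHomogeneous_polyLaplacian {N n : ℕ} {P : MvPolynomial (Fin N) ℝ}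
    (hP : P.IsHomogeneous (n + 2)) : (polyLaplacian N P).IsHomogeneous n := by
  rw [polyLaplacian_apply]
  exact IsHomogeneous.sum _ _ _ fun i _ => hP.pderiv.pderiv

theorem polyLaplacian_eq_zero {N n : ℕ} (hn : n < 2) {P : MvPolynomial (Fin N) ℝ}
    (hP : P.IsHomogeneous n) : polyLaplacian N P = 0 := by
  rw [polyLaplacian_apply]
  refine Finset.sum_eq_zero fun i _ => ?_
  have h : (pderiv i P).IsHomogeneous 0 := by
    have := hP.pderiv (i := i)
    rwa [show n - 1 = 0 by omega] at this
  rw [← totalDegree_zero_iff_isHomogeneous, totalDegree_eq_zero_iff_eq_C] at h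
  rw [h, pderiv_C]

theorem pderiv_normSqPoly {N : ℕ} (i : Fin N) : pderiv i (normSqPoly N) = 2 * X i := by
  simp only [normSqPoly, map_sum, pderiv_pow, pderiv_X]
  rw [Finset.sum_eq_single i]
  · simp
  · intro j _ hj
    simp [hj]
  · simp

/-- The commutator of the Laplacian with multiplication by `|x|²`. -/
theorem polyLaplacian_normSqPoly_mul {N m : ℕ} {Q : MvPolynomial (Fin N) ℝ}
    (hQ : Q.IsHomogeneous m) :
    polyLaplacian N (normSqPoly N * Q) =
      (2 * N + 4 * m : ℝ) • Q + normSqPoly N * polyLaplacian N Q := by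
  have hE := hQ.sum_X_mul_pderiv
  have h : ∀ i, pderiv i (pderiv i (normSqPoly N * Q)) =
      2 * Q + 4 * (X i * pderiv i Q) + normSqPoly N * pderiv i (pderiv i Q) := by
    intro i
    have h2 : pderiv i (2 : MvPolynomial (Fin N) ℝ) = 0 := pderiv_C (a := (2 : ℝ))
    simp only [pderiv_mul, pderiv_normSqPoly, map_add, h2, pderiv_X_self]
    ring
  simp only [polyLaplacian_apply, h, Finset.sum_add_distrib, ← Finset.mul_sum, hE]
  have h2 : (C 2 : MvPolynomial (Fin N) ℝ) = 2 := map_ofNat C 2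
  have h4 : (C 4 : MvPolynomial (Fin N) ℝ) = 4 := map_ofNat C 4
  simp [add_smul, smul_eq_C_mul, mul_assoc, mul_left_comm, h2, h4]

/-- Solvability of `c Q + |x|² Δ Q = P` among homogeneous polynomials. -/
theorem exists_smul_add_normSqPoly_mul_polyLaplacian_eq {N : ℕ} (m : ℕ) :
    ∀ P : MvPolynomial (Fin N) ℝ, P.IsHomogeneous m → ∀ c : ℝ, 0 < c →
      ∃ Q : MvPolynomial (Fin N) ℝ, Q.IsHomogeneous m ∧
        c • Q + normSqPoly N * polyLaplacian N Q = P := by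
  induction m using Nat.strong_induction_on with
  | _ m ih =>
    intro P hP c hc
    rcases lt_or_ge m 2 with hm | hm
    · refine ⟨c⁻¹ • P, ?_, ?_⟩
      · rw [smul_eq_C_mul]; exact hP.C_mul _
      · rw [map_smul, polyLaplacian_eq_zero hm hP, smul_zero, mul_zero, add_zero, smul_smul,
          mul_inv_cancel₀ hc.ne', one_smul]
    · obtain ⟨n, rfl⟩ := Nat.exists_eq_add_of_le' hm
      -- The Laplacian `Q'` of the solution satisfies an equation of the same kind in degree `n`.
      obtain ⟨Q', hQ', hQ'P⟩ := ih n (by omega) _ (isHomogeneous_polyLaplacian hP)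
        (c + (2 * N + 4 * n)) (by positivity)
      have hρ : (normSqPoly N * Q').IsHomogeneous (n + 2) := by
        rw [add_comm]; exact (isHomogeneous_normSqPoly N).mul hQ'
      have hL : polyLaplacian N (c⁻¹ • (P - normSqPoly N * Q')) = Q' := by
        rw [map_smul, map_sub, polyLaplacian_normSqPoly_mul hQ', ← hQ'P, inv_smul_eq_iff₀ hc.ne']
        module
      refine ⟨c⁻¹ • (P - normSqPoly N * Q'), ?_, ?_⟩
      · rw [smul_eq_C_mul]; exact (hP.sub hρ).C_mul _
      · rw [hL, smul_smul, mul_inv_cancel₀ hc.ne', one_smul, sub_add_cancel]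

/-- The decomposition of a homogeneous polynomial that underlies the completeness of spherical
harmonics. -/
theorem exists_harmonicPoly_add_normSqPoly_mul {N m : ℕ} (hN : 0 < N)
    {P : MvPolynomial (Fin N) ℝ} (hP : P.IsHomogeneous (m + 2)) :
    ∃ H ∈ harmonicPoly N (m + 2), ∃ Q : MvPolynomial (Fin N) ℝ, Q.IsHomogeneous m ∧
      P = H + normSqPoly N * Q := by
  have hN' : (0 : ℝ) < N := by exact_mod_cast hN
  obtain ⟨Q, hQ, hQP⟩ := exists_smul_add_normSqPoly_mul_polyLaplacian_eq m _
    (isHomogeneous_polyLaplacian hP) (2 * N + 4 * m) (by positivity)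
  have hρ : (normSqPoly N * Q).IsHomogeneous (m + 2) := by
    rw [add_comm]; exact (isHomogeneous_normSqPoly N).mul hQ
  refine ⟨P - normSqPoly N * Q, ⟨hP.sub hρ, ?_⟩, Q, hQ, by ring⟩
  rw [SetLike.mem_coe, LinearMap.mem_ker, map_sub, polyLaplacian_normSqPoly_mul hQ, hQP, sub_self]

theorem mem_harmonicPoly_of_lt_two {N m : ℕ} (hm : m < 2) {P : MvPolynomial (Fin N) ℝ}
    (hP : P.IsHomogeneous m) : P ∈ harmonicPoly N m :=
  ⟨hP, polyLaplacian_eq_zero hm hP⟩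

/-- Half the sum of the squares of the infinitesimal rotations is the Laplacian of the sphere:
harmonic homogeneous polynomials of degree `n` are eigenvectors. -/
theorem sum_rotPoly_rotPoly {N n : ℕ} {P : MvPolynomial (Fin N) ℝ} (hP : P ∈ harmonicPoly N n) :
    ∑ i, ∑ k, rotPoly i k (rotPoly i k P) = (-2 * sphereEigenvalue N n) • P := by
  obtain ⟨hn, hΔ⟩ := hP
  have hn : P.IsHomogeneous n := hn
  rw [SetLike.mem_coe, LinearMap.mem_ker, polyLaplacian_apply] at hΔ
  have hE := hn.sum_X_mul_pderiv
  have hE2 : ∀ k, ∑ i, X i * pderiv i (pderiv k P) = (n - 1) • pderiv k P := fun k =>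
    hn.pderiv.sum_X_mul_pderiv
  have key : ∀ i k : Fin N, rotPoly i k (rotPoly i k P) =
      X i ^ 2 * pderiv k (pderiv k P) + X k ^ 2 * pderiv i (pderiv i P)
      - X k * (X i * pderiv i (pderiv k P)) - X i * (X k * pderiv k (pderiv i P))
      - X i * pderiv i P - X k * pderiv k P
      + (if i = k then X i * pderiv k P + X k * pderiv i P else 0) := by
    intro i k
    simp only [rotPoly, map_sub, pderiv_mul, pderiv_X_self]
    by_cases h : i = k
    · subst h
      simp only [pderiv_X_self, if_true]
      ring
    · simp only [pderiv_X_of_ne h, pderiv_X_of_ne (Ne.symm h), if_neg h]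
      ring
  have h1 : ∑ i : Fin N, ∑ k : Fin N, X i ^ 2 * pderiv k (pderiv k P) = 0 := by
    simp [← Finset.mul_sum, hΔ]
  have h2 : ∑ i : Fin N, ∑ k : Fin N, X k ^ 2 * pderiv i (pderiv i P) = 0 := by
    rw [Finset.sum_comm]; exact h1
  have h4 : ∑ i : Fin N, ∑ k : Fin N, X i * (X k * pderiv k (pderiv i P)) =
      (n - 1) • n • P := by
    simp only [← Finset.mul_sum, hE2, mul_smul_comm]
    rw [← Finset.smul_sum, hE]
  have h3 : ∑ i : Fin N, ∑ k : Fin N, X k * (X i * pderiv i (pderiv k P)) =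
      (n - 1) • n • P := by
    rw [Finset.sum_comm]; exact h4
  have h5 : ∑ i : Fin N, ∑ k : Fin N, X k * pderiv k P = N • n • P := by
    simp [hE]
  have h6 : ∑ i : Fin N, ∑ k : Fin N, X i * pderiv i P = N • n • P := by
    rw [Finset.sum_comm]; exact h5
  have h7 : ∑ i : Fin N, ∑ k : Fin N,
      (if i = k then X i * pderiv k P + X k * pderiv i P else 0) = n • P + n • P := by
    simp [Finset.sum_add_distrib, hE]
  simp only [key, Finset.sum_add_distrib, Finset.sum_sub_distrib, h1, h2, h3, h4, h5, h6, h7]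
  rcases n with _ | n
  · simp [sphereEigenvalue]
  · simp only [Nat.add_sub_cancel, sphereEigenvalue, ← Nat.cast_smul_eq_nsmul ℝ]
    push_cast
    module

theorem sphereEigenvalue_strictMono {N : ℕ} (hN : 2 ≤ N) : StrictMono (sphereEigenvalue N) := by
  have hN' : (2 : ℝ) ≤ N := by exact_mod_cast hN
  intro m n h
  have h' : (m : ℝ) < n := by exact_mod_cast h
  have hm : (0 : ℝ) ≤ m := by positivity
  simp only [sphereEigenvalue]
  nlinarith

end Polynomials

/-! ### Infinitesimal rotations of the sphere -/

/-- The infinitesimal rotation in the `(i, k)` coordinate plane, as a vector field on `ℝ^N`. -/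
def rotField {N : ℕ} (i k : Fin N) (x : E N) : E N :=
  x i • EuclideanSpace.single k 1 - x k • EuclideanSpace.single i 1

/-- The derivative `xᵢ ∂ₖ f - xₖ ∂ᵢ f` of a function along an infinitesimal rotation. -/
def rot {N : ℕ} (i k : Fin N) (f : E N → ℝ) (x : E N) : ℝ := fderiv ℝ f x (rotField i k x)

theorem rot_self {N : ℕ} (i : Fin N) (f : E N → ℝ) (x : E N) : rot i i f x = 0 := by
  simp [rot, rotField]

theorem contDiff_rot {N : ℕ} (i k : Fin N) {f : E N → ℝ} (hf : ContDiff ℝ ∞ f) :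
    ContDiff ℝ ∞ (rot i k f) := by
  refine (hf.fderiv_right (m := ∞) (by simp)).clm_apply ?_
  unfold rotField
  fun_prop

theorem rot_mul {N : ℕ} (i k : Fin N) {f g : E N → ℝ} (hf : ContDiff ℝ ∞ f)
    (hg : ContDiff ℝ ∞ g) (x : E N) :
    rot i k (fun y => f y * g y) x = f x * rot i k g x + g x * rot i k f x := by
  have hf' := (hf.differentiable (by simp)) x
  have hg' := (hg.differentiable (by simp)) x
  simp [rot, fderiv_fun_mul hf' hg']

theorem hasFDerivAt_eval {N : ℕ} (P : MvPolynomial (Fin N) ℝ) (x : E N) :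
    HasFDerivAt (fun y : E N => MvPolynomial.eval (fun i => y i) P)
      (∑ i, MvPolynomial.eval (fun i => x i) (MvPolynomial.pderiv i P) •
        (EuclideanSpace.proj i : E N →L[ℝ] ℝ)) x := by
  induction P using MvPolynomial.induction_on with
  | C a =>
    simp only [MvPolynomial.eval_C, MvPolynomial.pderiv_C, map_zero, zero_smul,
      Finset.sum_const_zero]
    exact hasFDerivAt_const _ _
  | add p q hp hq =>
    simp only [map_add, add_smul, Finset.sum_add_distrib]
    exact hp.add hq
  | mul_X p n hp =>
    simp only [map_mul, MvPolynomial.eval_X]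
    have hn : HasFDerivAt (fun y : E N => y n) (EuclideanSpace.proj n : E N →L[ℝ] ℝ) x :=
      (EuclideanSpace.proj n : E N →L[ℝ] ℝ).hasFDerivAt
    refine (hp.mul hn).congr_fderiv ?_
    have h : ∀ i : Fin N, MvPolynomial.eval (fun i => x i)
        (MvPolynomial.pderiv i (p * MvPolynomial.X n)) •
          (EuclideanSpace.proj i : E N →L[ℝ] ℝ) =
        (if n = i then MvPolynomial.eval (fun i => x i) p •
          (EuclideanSpace.proj i : E N →L[ℝ] ℝ) else 0) +
        x n • MvPolynomial.eval (fun i => x i) (MvPolynomial.pderiv i p) •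
          (EuclideanSpace.proj i : E N →L[ℝ] ℝ) := by
      intro i
      by_cases hi : n = i
      · subst hi
        simp [add_smul, smul_smul]
      · simp [MvPolynomial.pderiv_X_of_ne hi, hi, smul_smul]
    simp only [h, Finset.sum_add_distrib, Finset.sum_ite_eq, Finset.mem_univ, if_true,
      Finset.smul_sum]

theorem contDiff_eval {N : ℕ} (P : MvPolynomial (Fin N) ℝ) :
    ContDiff ℝ ∞ (fun y : E N => MvPolynomial.eval (fun i => y i) P) := by
  induction P using MvPolynomial.induction_on with
  | C a => simpa using contDiff_const
  | add p q hp hq => simpa using hp.add hq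
  | mul_X p n hp =>
    simp only [map_mul, MvPolynomial.eval_X]
    exact hp.mul (by fun_prop)

theorem rot_eval {N : ℕ} (i k : Fin N) (P : MvPolynomial (Fin N) ℝ) :
    rot i k (fun y : E N => MvPolynomial.eval (fun i => y i) P) =
      fun y : E N => MvPolynomial.eval (fun i => y i) (rotPoly i k P) := by
  ext x
  simp [rot, (hasFDerivAt_eval P x).fderiv, rotField, rotPoly, mul_comm]
  simp only [sub_mul, Finset.sum_sub_distrib]
  simp

/-- The rotation by the angle `t` in the `(i, k)` coordinate plane. -/
def planeRotation {N : ℕ} {i k : Fin N} (hik : i ≠ k) (t : ℝ) : E N ≃ₗᵢ[ℝ] E N :=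
  LinearIsometry.toLinearIsometryEquiv
    { toFun := fun x => x + ((Real.cos t - 1) * x i - Real.sin t * x k) • EuclideanSpace.single i 1
        + (Real.sin t * x i + (Real.cos t - 1) * x k) • EuclideanSpace.single k 1
      map_add' := fun x y => by
        simp only [PiLp.add_apply]
        module
      map_smul' := fun c x => by
        simp only [PiLp.smul_apply, smul_eq_mul, RingHom.id_apply]
        module
      norm_map' := fun x => by
        have hcs := Real.sin_sq_add_cos_sq t
        have h : ∀ a b : ℝ, ‖x + a • EuclideanSpace.single i (1 : ℝ)
            + b • EuclideanSpace.single k (1 : ℝ)‖ ^ 2 =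
            ‖x‖ ^ 2 + 2 * a * x i + 2 * b * x k + a ^ 2 + b ^ 2 := by
          intro a b
          rw [norm_add_sq_real, norm_add_sq_real]
          simp [inner_add_left, inner_smul_left, inner_smul_right, norm_smul,
            EuclideanSpace.inner_single_right, hik]
          ring
        refine (sq_eq_sq₀ (norm_nonneg _) (norm_nonneg _)).mp ?_
        refine (h _ _).trans ?_
        linear_combination (x i ^ 2 + x k ^ 2) * hcs } rfl

theorem planeRotation_apply {N : ℕ} {i k : Fin N} (hik : i ≠ k) (t : ℝ) (x : E N) :
    planeRotation hik t x =
      x + ((Real.cos t - 1) * x i - Real.sin t * x k) • EuclideanSpace.single i 1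
        + (Real.sin t * x i + (Real.cos t - 1) * x k) • EuclideanSpace.single k 1 := rfl

theorem hasDerivAt_planeRotation {N : ℕ} {i k : Fin N} (hik : i ≠ k) (t : ℝ) (x : E N) :
    HasDerivAt (fun t => planeRotation hik t x) (rotField i k (planeRotation hik t x)) t := by
  have hc := Real.hasDerivAt_cos t
  have hs := Real.hasDerivAt_sin t
  have h := (((((hc.sub_const 1).mul_const (x i)).sub (hs.mul_const (x k))).smul_const
      (EuclideanSpace.single i (1 : ℝ) : E N)).const_add x).add
    (((hs.mul_const (x i)).add ((hc.sub_const 1).mul_const (x k))).smul_const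
      (EuclideanSpace.single k (1 : ℝ) : E N))
  refine h.congr_deriv ?_
  have hi : planeRotation hik t x i = Real.cos t * x i - Real.sin t * x k := by
    simp [planeRotation_apply, hik]; ring
  have hk : planeRotation hik t x k = Real.sin t * x i + Real.cos t * x k := by
    simp [planeRotation_apply, hik.symm]; ring
  rw [rotField, hi, hk]
  module

/-- The map of the unit sphere induced by a linear isometry. -/
def sphereMap {N : ℕ} (L : E N ≃ₗᵢ[ℝ] E N) (σ : sphere (0 : E N) 1) : sphere (0 : E N) 1 :=
  ⟨L σ, by simp⟩

theorem continuous_sphereMap {N : ℕ} (L : E N ≃ₗᵢ[ℝ] E N) : Continuous (sphereMap L) :=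
  (L.continuous.comp continuous_subtype_val).subtype_mk _

open scoped Pointwise in
theorem measurePreserving_sphereMap {N : ℕ} (L : E N ≃ₗᵢ[ℝ] E N) :
    MeasurePreserving (sphereMap L) (sphereMeasure N) (sphereMeasure N) := by
  have hm := (continuous_sphereMap L).measurable
  refine ⟨hm, Measure.ext fun s hs => ?_⟩
  have hv := L.measurePreserving.measure_preimage_equiv (f := L.toMeasurableEquiv)
    (Ioo (0 : ℝ) 1 • (Subtype.val '' s))
  rw [Measure.map_apply hm hs, Measure.toSphere_apply' _ (hm hs), Measure.toSphere_apply' _ hs,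
    ← hv]
  congr 2
  ext x
  simp only [Set.mem_smul, mem_preimage, mem_image]
  constructor
  · rintro ⟨t, ht, _, ⟨σ, hσ, rfl⟩, rfl⟩
    exact ⟨t, ht, _, ⟨_, hσ, rfl⟩, (L.map_smul t σ).symm⟩
  · rintro ⟨t, ht, _, ⟨σ, hσ, rfl⟩, h⟩
    refine ⟨t, ht, _, ⟨sphereMap L.symm σ, ?_, rfl⟩, ?_⟩
    · have : sphereMap L (sphereMap L.symm σ) = σ := Subtype.ext (L.apply_symm_apply _)
      rwa [this]
    · have : L x = t • (σ : E N) := h.symm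
      simp [sphereMap, ← L.symm.map_smul, ← this]

theorem integrable_sphere {N : ℕ} {f : E N → ℝ} (hf : Continuous f) :
    Integrable (fun σ : sphere (0 : E N) 1 => f σ) (sphereMeasure N) :=
  (hf.comp continuous_subtype_val).integrable_of_hasCompactSupport
    (HasCompactSupport.of_compactSpace _)

/-- The surface measure is invariant under rotations, so the derivative of a function along an
infinitesimal rotation has mean value zero. -/
theorem integral_rot {N : ℕ} (i k : Fin N) {f : E N → ℝ} (hf : ContDiff ℝ ∞ f) :
    ∫ σ : sphere (0 : E N) 1, rot i k f σ ∂(sphereMeasure N) = 0 := by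
  by_cases hik : i = k
  · subst hik
    simp [rot_self]
  have hr := (contDiff_rot i k hf).continuous
  obtain ⟨C, hC⟩ := (isCompact_sphere (0 : E N) 1).exists_bound_of_continuousOn hr.continuousOn
  have hconst : ∀ t, ∫ σ : sphere (0 : E N) 1, f (planeRotation hik t σ) ∂(sphereMeasure N) =
      ∫ σ : sphere (0 : E N) 1, f σ ∂(sphereMeasure N) := by
    intro t
    have hp := measurePreserving_sphereMap (planeRotation hik t)
    conv_rhs => rw [← hp.map_eq]
    rw [integral_map hp.aemeasurable]
    · rfl
    · exact (hf.continuous.comp continuous_subtype_val).aestronglyMeasurable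
  have hd := (hasDerivAt_integral_of_dominated_loc_of_deriv_le (𝕜 := ℝ) (x₀ := (0 : ℝ))
    (μ := sphereMeasure N) (s := univ) (bound := fun _ => C)
    (F := fun t (σ : sphere (0 : E N) 1) => f (planeRotation hik t σ))
    (F' := fun t (σ : sphere (0 : E N) 1) => rot i k f (planeRotation hik t σ)) Filter.univ_mem
    (Filter.Eventually.of_forall fun t =>
      (integrable_sphere (hf.continuous.comp
        (planeRotation hik t).continuous)).aestronglyMeasurable)
    (integrable_sphere (hf.continuous.comp (planeRotation hik 0).continuous))
    (integrable_sphere (hr.comp (planeRotation hik 0).continuous)).aestronglyMeasurable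
    (Filter.Eventually.of_forall fun σ t _ => hC _ (by simp))
    (integrable_const _)
    (Filter.Eventually.of_forall fun σ t _ =>
      (hf.differentiable (by simp) _).hasFDerivAt.comp_hasDerivAt t
        (hasDerivAt_planeRotation hik t σ))).2
  simp only [hconst] at hd
  have h0 := hd.unique (hasDerivAt_const _ _)
  simpa [planeRotation_apply] using h0

theorem integral_rot_mul {N : ℕ} (i k : Fin N) {f g : E N → ℝ} (hf : ContDiff ℝ ∞ f)
    (hg : ContDiff ℝ ∞ g) :
    ∫ σ : sphere (0 : E N) 1, rot i k f σ * g σ ∂(sphereMeasure N) =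
      -∫ σ : sphere (0 : E N) 1, f σ * rot i k g σ ∂(sphereMeasure N) := by
  have h := integral_rot i k (hf.mul hg)
  have h' : ∀ σ : sphere (0 : E N) 1, rot i k (fun y => f y * g y) σ =
      f σ * rot i k g σ + rot i k f σ * g σ := fun σ => by
    rw [rot_mul i k hf hg]; ring
  simp only [h'] at h
  rw [integral_add (integrable_sphere (f := fun x => f x * rot i k g x)
      (hf.continuous.mul (contDiff_rot i k hg).continuous))
    (integrable_sphere (f := fun x => rot i k f x * g x)
      ((contDiff_rot i k hf).continuous.mul hg.continuous))] at h
  linarith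

/-- The Laplacian of the unit sphere, as half the sum of the squares of the infinitesimal
rotations (every coordinate plane occurs twice). -/
def sphereLaplacian {N : ℕ} (f : E N → ℝ) (x : E N) : ℝ :=
  (1 / 2) * ∑ i, ∑ k, rot i k (rot i k f) x

/-- The squared length of the gradient along the unit sphere. -/
def sphereGradSq {N : ℕ} (f : E N → ℝ) (x : E N) : ℝ :=
  (1 / 2) * ∑ i, ∑ k, rot i k f x ^ 2

theorem continuous_sphereLaplacian {N : ℕ} {f : E N → ℝ} (hf : ContDiff ℝ ∞ f) :
    Continuous (sphereLaplacian f) :=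
  continuous_const.mul (continuous_finsetSum _ fun i _ => continuous_finsetSum _ fun k _ =>
    (contDiff_rot i k (contDiff_rot i k hf)).continuous)

theorem sphereLaplacian_eval {N n : ℕ} {P : MvPolynomial (Fin N) ℝ} (hP : P ∈ harmonicPoly N n)
    (x : E N) :
    sphereLaplacian (fun y : E N => MvPolynomial.eval (fun i => y i) P) x =
      -sphereEigenvalue N n * MvPolynomial.eval (fun i => x i) P := by
  simp only [sphereLaplacian, rot_eval, ← map_sum, sum_rotPoly_rotPoly hP,
    MvPolynomial.smul_eval]
  ring

theorem integral_sphereLaplacian_mul_eq_neg {N : ℕ} {f g : E N → ℝ} (hf : ContDiff ℝ ∞ f)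
    (hg : ContDiff ℝ ∞ g) :
    ∫ σ : sphere (0 : E N) 1, sphereLaplacian f σ * g σ ∂(sphereMeasure N) =
      -((1 / 2) * ∑ i, ∑ k,
        ∫ σ : sphere (0 : E N) 1, rot i k f σ * rot i k g σ ∂(sphereMeasure N)) := by
  simp only [sphereLaplacian, mul_assoc, Finset.sum_mul]
  rw [integral_const_mul, integral_finsetSum]
  · rw [← mul_neg, ← Finset.sum_neg_distrib]
    congr 1
    refine Finset.sum_congr rfl fun i _ => ?_
    rw [integral_finsetSum, ← Finset.sum_neg_distrib]
    · exact Finset.sum_congr rfl fun k _ => integral_rot_mul i k (contDiff_rot i k hf) hg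
    · intro k _
      exact integrable_sphere (f := fun x => rot i k (rot i k f) x * g x)
        ((contDiff_rot i k (contDiff_rot i k hf)).continuous.mul hg.continuous)
  · intro i _
    exact integrable_sphere (f := fun x => ∑ k, rot i k (rot i k f) x * g x)
      (continuous_finsetSum _ fun k _ =>
        (contDiff_rot i k (contDiff_rot i k hf)).continuous.mul hg.continuous)

theorem integral_sphereLaplacian_mul {N : ℕ} {f g : E N → ℝ} (hf : ContDiff ℝ ∞ f)
    (hg : ContDiff ℝ ∞ g) :
    ∫ σ : sphere (0 : E N) 1, sphereLaplacian f σ * g σ ∂(sphereMeasure N) =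
      ∫ σ : sphere (0 : E N) 1, f σ * sphereLaplacian g σ ∂(sphereMeasure N) := by
  simp only [mul_comm (f _), integral_sphereLaplacian_mul_eq_neg hf hg,
    integral_sphereLaplacian_mul_eq_neg hg hf, mul_comm (rot _ _ g _)]

theorem integral_sphereLaplacian_mul_self {N : ℕ} {f : E N → ℝ} (hf : ContDiff ℝ ∞ f) :
    ∫ σ : sphere (0 : E N) 1, sphereLaplacian f σ * f σ ∂(sphereMeasure N) =
      -∫ σ : sphere (0 : E N) 1, sphereGradSq f σ ∂(sphereMeasure N) := by
  rw [integral_sphereLaplacian_mul_eq_neg hf hf]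
  simp only [sphereGradSq]
  rw [integral_const_mul, integral_finsetSum]
  · congr 2
    refine Finset.sum_congr rfl fun i _ => ?_
    rw [integral_finsetSum]
    · simp only [sq]
    · intro k _
      exact integrable_sphere (f := fun x => rot i k f x ^ 2)
        ((contDiff_rot i k hf).continuous.pow 2)
  · intro i _
    exact integrable_sphere (f := fun x => ∑ k, rot i k f x ^ 2)
      (continuous_finsetSum _ fun k _ => (contDiff_rot i k hf).continuous.pow 2)

/-! ### The expansion of smooth functions into spherical harmonics -/

/-- The restriction to the unit sphere of a continuous function on `ℝ^N`, as an element of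
`L²(S^{N-1})`. -/
def sphereLp {N : ℕ} (f : C(E N, ℝ)) : Lp ℝ 2 (sphereMeasure N) :=
  ContinuousMap.toLp (E := ℝ) 2 (sphereMeasure N) ℝ (f.restrict (sphere 0 1))

theorem inner_sphereLp {N : ℕ} (f g : C(E N, ℝ)) :
    ⟪sphereLp f, sphereLp g⟫ =
      ∫ σ : sphere (0 : E N) 1, f σ * g σ ∂(sphereMeasure N) := by
  simp [sphereLp, ContinuousMap.inner_toLp, mul_comm]

/-- The polynomial function of a polynomial in `N` variables. -/
def polyFun {N : ℕ} (P : MvPolynomial (Fin N) ℝ) : C(E N, ℝ) :=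
  ⟨fun y => MvPolynomial.eval (fun i => y i) P, (contDiff_eval P).continuous⟩

theorem mem_sphericalHarmonics_iff {N n : ℕ} {h : Lp ℝ 2 (sphereMeasure N)} :
    h ∈ sphericalHarmonics N n ↔ ∃ P ∈ harmonicPoly N n, sphereLp (polyFun P) = h :=
  Iff.rfl

theorem inner_sphereLaplacian_sphericalHarmonics {N n : ℕ} {f : C(E N, ℝ)}
    (hf : ContDiff ℝ ∞ f) {h : Lp ℝ 2 (sphereMeasure N)} (hh : h ∈ sphericalHarmonics N n) :
    ⟪sphereLp ⟨_, continuous_sphereLaplacian hf⟩, h⟫ =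
      -sphereEigenvalue N n * ⟪sphereLp f, h⟫ := by
  obtain ⟨P, hP, rfl⟩ := mem_sphericalHarmonics_iff.mp hh
  rw [inner_sphereLp, inner_sphereLp]
  refine (integral_sphereLaplacian_mul hf (contDiff_eval P)).trans ?_
  simp only [sphereLaplacian_eval hP, polyFun, ContinuousMap.coe_mk, mul_left_comm (f _)]
  rw [integral_const_mul]

theorem isOrtho_sphericalHarmonics {N : ℕ} (hN : 2 ≤ N) {m n : ℕ} (hmn : m ≠ n) :
    sphericalHarmonics N m ⟂ sphericalHarmonics N n := by
  rw [Submodule.isOrtho_iff_inner_eq]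
  intro f hf g hg
  obtain ⟨P, hP, rfl⟩ := mem_sphericalHarmonics_iff.mp hf
  have h := inner_sphereLaplacian_sphericalHarmonics (f := polyFun P) (contDiff_eval P) hg
  have hΔ : sphereLp ⟨_, continuous_sphereLaplacian (contDiff_eval P)⟩ =
      -sphereEigenvalue N m • sphereLp (polyFun P) := by
    rw [sphereLp, sphereLp, ← map_smul]
    congr 1
    ext σ
    exact sphereLaplacian_eval hP _
  have h' := congrArg (fun x => ⟪x, g⟫) hΔ
  simp only [inner_smul_left] at h'
  have hne := (sphereEigenvalue_strictMono hN).injective.ne hmn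
  have : (sphereEigenvalue N m - sphereEigenvalue N n) * ⟪sphereLp (polyFun P), g⟫ = 0 := by
    have e := h'.symm.trans h
    simp only [RCLike.conj_to_real] at e
    linarith
  exact (mul_eq_zero.mp this).resolve_left (sub_ne_zero.mpr hne)

theorem sphereLp_polyFun_mem_of_isHomogeneous {N : ℕ} (hN : 0 < N) (m : ℕ) :
    ∀ P : MvPolynomial (Fin N) ℝ, P.IsHomogeneous m →
      sphereLp (polyFun P) ∈ ⨆ n, sphericalHarmonics N n := by
  induction m using Nat.strong_induction_on with
  | _ m ih =>
    intro P hP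
    rcases lt_or_ge m 2 with hm | hm
    · exact Submodule.mem_iSup_of_mem m ⟨P, mem_harmonicPoly_of_lt_two hm hP, rfl⟩
    · obtain ⟨n, rfl⟩ := Nat.exists_eq_add_of_le' hm
      obtain ⟨H, hH, Q, hQ, rfl⟩ := exists_harmonicPoly_add_normSqPoly_mul hN hP
      -- The factor `|x|²` is `1` on the sphere.
      have : sphereLp (polyFun (H + normSqPoly N * Q)) =
          sphereLp (polyFun H) + sphereLp (polyFun Q) := by
        rw [sphereLp, sphereLp, sphereLp, ← map_add]
        congr 1
        ext σ
        have h1 : ∑ i, (σ : E N) i ^ 2 = 1 := by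
          have := EuclideanSpace.norm_sq_eq (σ : E N)
          simpa using this.symm
        simp [polyFun, normSqPoly, h1]
      rw [this]
      exact add_mem (Submodule.mem_iSup_of_mem _ ⟨H, hH, rfl⟩) (ih n (by omega) Q hQ)

theorem sphereLp_polyFun_mem {N : ℕ} (hN : 0 < N) (P : MvPolynomial (Fin N) ℝ) :
    sphereLp (polyFun P) ∈ ⨆ n, sphericalHarmonics N n := by
  let Φ : MvPolynomial (Fin N) ℝ →ₗ[ℝ] Lp ℝ 2 (sphereMeasure N) :=
    (ContinuousMap.toLp (E := ℝ) 2 (sphereMeasure N) ℝ).toLinearMap ∘ₗ restrictSphere N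
  have hΦ : ∀ P, sphereLp (polyFun P) = Φ P := fun P => rfl
  rw [hΦ, ← MvPolynomial.sum_homogeneousComponent P, map_sum]
  exact sum_mem fun i _ => sphereLp_polyFun_mem_of_isHomogeneous hN i _
    (MvPolynomial.homogeneousComponent_isHomogeneous i P)

/-- The restrictions of polynomials to the sphere, as an algebra of continuous functions. -/
def spherePolynomials (N : ℕ) : Subalgebra ℝ C(sphere (0 : E N) 1, ℝ) :=
  (MvPolynomial.aeval fun i : Fin N =>
    (⟨fun σ => (σ : E N) i, by fun_prop⟩ : C(sphere (0 : E N) 1, ℝ))).range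

theorem separatesPoints_spherePolynomials (N : ℕ) : (spherePolynomials N).SeparatesPoints := by
  intro σ τ h
  obtain ⟨i, hi⟩ : ∃ i, (σ : E N) i ≠ (τ : E N) i := by
    by_contra! hc
    exact h (Subtype.ext (PiLp.ext hc))
  exact ⟨_, ⟨_, ⟨MvPolynomial.X i, rfl⟩, rfl⟩, by simpa using hi⟩

theorem dense_iSup_sphericalHarmonics {N : ℕ} (hN : 0 < N) :
    ⊤ ≤ (⨆ n, sphericalHarmonics N n).topologicalClosure := by
  have h1 := ContinuousMap.subalgebra_topologicalClosure_eq_top_of_separatesPoints _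
    (separatesPoints_spherePolynomials N)
  have h2 : (Subalgebra.toSubmodule (spherePolynomials N)).topologicalClosure = ⊤ := by
    refine SetLike.coe_injective ?_
    have := congrArg (fun A : Subalgebra ℝ C(sphere (0 : E N) 1, ℝ) =>
      (A : Set C(sphere (0 : E N) 1, ℝ))) h1
    simpa [Submodule.topologicalClosure_coe, Subalgebra.topologicalClosure_coe] using this
  have h3 := (ContinuousMap.toLp_denseRange ℝ (sphereMeasure N) ℝ
    (p := 2) (by simp)).topologicalClosure_map_submodule h2
  rw [← h3]
  refine Submodule.topologicalClosure_mono ?_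
  rintro _ ⟨f, ⟨P, rfl⟩, rfl⟩
  have : sphereLp (polyFun P) ∈ ⨆ n, sphericalHarmonics N n := sphereLp_polyFun_mem hN P
  refine Eq.mp (congrArg (· ∈ ⨆ n, sphericalHarmonics N n) ?_) this
  refine congrArg (ContinuousMap.toLp (E := ℝ) 2 (sphereMeasure N) ℝ)
    (ContinuousMap.ext fun σ => ?_)
  have h : ContinuousMap.evalAlgHom ℝ ℝ σ (MvPolynomial.aeval (fun i : Fin N =>
      (⟨fun σ => (σ : E N) i, by fun_prop⟩ : C(sphere (0 : E N) 1, ℝ))) P) =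
      MvPolynomial.eval (fun i => (σ : E N) i) P := by
    rw [← AlgHom.comp_apply, MvPolynomial.comp_aeval, ← MvPolynomial.coe_aeval_eq_eval]
    rfl
  exact h.symm

theorem isHilbertSum_sphericalHarmonics {N : ℕ} (hN : 2 ≤ N) :
    IsHilbertSum ℝ (fun n => sphericalHarmonics N n) fun n => (sphericalHarmonics N n).subtypeₗᵢ :=
  IsHilbertSum.mkInternal _
    (OrthogonalFamily.of_pairwise fun _ _ h => isOrtho_sphericalHarmonics hN h)
    (dense_iSup_sphericalHarmonics (by omega))

/-- Completeness of the spherical harmonics. -/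
theorem hasSum_starProjection_sphericalHarmonics {N : ℕ} (hN : 2 ≤ N)
    (a : Lp ℝ 2 (sphereMeasure N)) :
    HasSum (fun n => (sphericalHarmonics N n).starProjection a) a := by
  have hV := isHilbertSum_sphericalHarmonics hN
  have h := hV.hasSum_linearIsometryEquiv_symm (hV.linearIsometryEquiv a)
  rw [LinearIsometryEquiv.symm_apply_apply] at h
  convert h using 2 with n
  have h' := h.mapL (sphericalHarmonics N n).starProjection
  refine h'.unique ?_
  convert hasSum_single n ?_ using 1
  · exact (Submodule.starProjection_eq_self_iff.mpr (Subtype.coe_prop _)).symm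
  · intro m hm
    refine (sphericalHarmonics N n).starProjection_apply_eq_zero_iff.mpr ?_
    exact (isOrtho_sphericalHarmonics hN hm) (Subtype.coe_prop _)

theorem hasSum_inner_starProjection_sphericalHarmonics {N : ℕ} (hN : 2 ≤ N)
    (a b : Lp ℝ 2 (sphereMeasure N)) :
    HasSum (fun n => ⟪(sphericalHarmonics N n).starProjection a, b⟫) ⟪a, b⟫ := by
  have h := (hasSum_starProjection_sphericalHarmonics hN a).mapL (innerSL ℝ b)
  simpa [real_inner_comm b] using h

theorem inner_starProjection_self {H : Type*} [NormedAddCommGroup H] [InnerProductSpace ℝ H]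
    (K : Submodule ℝ H) [K.HasOrthogonalProjection] (a : H) :
    ⟪K.starProjection a, a⟫ = ‖K.starProjection a‖ ^ 2 :=
  K.re_inner_starProjection_eq_normSq a

theorem hasSum_norm_sq_starProjection {N : ℕ} (hN : 2 ≤ N) (f : C(E N, ℝ)) :
    HasSum (fun n => ‖(sphericalHarmonics N n).starProjection (sphereLp f)‖ ^ 2)
      (∫ σ : sphere (0 : E N) 1, f σ ^ 2 ∂(sphereMeasure N)) := by
  have h := hasSum_inner_starProjection_sphericalHarmonics hN (sphereLp f) (sphereLp f)
  simp only [inner_sphereLp, ← sq] at h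
  convert h using 2 with n
  exact (inner_starProjection_self _ _).symm

/-- The Dirichlet form of the sphere is diagonal in the spherical harmonics. -/
theorem hasSum_sphereEigenvalue_mul_norm_sq {N : ℕ} (hN : 2 ≤ N) {f : C(E N, ℝ)}
    (hf : ContDiff ℝ ∞ f) :
    HasSum (fun n => sphereEigenvalue N n *
        ‖(sphericalHarmonics N n).starProjection (sphereLp f)‖ ^ 2)
      (∫ σ : sphere (0 : E N) 1, sphereGradSq f σ ∂(sphereMeasure N)) := by
  have h := (hasSum_inner_starProjection_sphericalHarmonics hN (sphereLp f)
    (sphereLp ⟨_, continuous_sphereLaplacian hf⟩)).neg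
  have hs : -⟪sphereLp f, sphereLp ⟨_, continuous_sphereLaplacian hf⟩⟫ =
      ∫ σ : sphere (0 : E N) 1, sphereGradSq f σ ∂(sphereMeasure N) := by
    rw [real_inner_comm, inner_sphereLp]
    simp only [ContinuousMap.coe_mk]
    rw [integral_sphereLaplacian_mul_self hf, neg_neg]
  rw [hs] at h
  refine h.congr_fun fun n => ?_
  rw [real_inner_comm, inner_sphereLaplacian_sphericalHarmonics hf
    (Submodule.starProjection_apply_mem _ _), real_inner_comm,
    inner_starProjection_self]
  ring

/-! ### Lorentz boosts and the volume in geodesic polar coordinates -/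

theorem norm_sq_eq_height_sq_sub_one {N : ℕ} (x : E N) : ‖x‖ ^ 2 = height x ^ 2 - 1 := by
  linarith [height_sq x]

/-- The Lorentz boost that moves the origin to `x₀`, in the chart `(x, t) ↦ x`. -/
def boost {N : ℕ} (x₀ y : E N) : E N := height y • x₀ + frame x₀ y

theorem height_boost {N : ℕ} (x₀ y : E N) :
    height (boost x₀ y) = height x₀ * height y + ⟪x₀, y⟫ := by
  have hp := height_pos x₀
  have hy := height_pos y
  have hx := norm_sq_eq_height_sq_sub_one x₀
  have hy2 := norm_sq_eq_height_sq_sub_one y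
  have hs : |⟪x₀, y⟫| ≤ height x₀ * height y := by
    refine (abs_real_inner_le_norm x₀ y).trans (mul_le_mul ?_ ?_ (norm_nonneg _) hp.le)
    · exact Real.le_sqrt_of_sq_le (by linarith)
    · exact Real.le_sqrt_of_sq_le (by linarith)
  have hnn : 0 ≤ height x₀ * height y + ⟪x₀, y⟫ := by linarith [neg_abs_le ⟪x₀, y⟫]
  rw [height, Real.sqrt_eq_iff_mul_self_eq (by positivity) hnn, ← real_inner_self_eq_norm_sq]
  simp only [boost, frame, inner_add_left, inner_add_right, inner_smul_left, inner_smul_right,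
    real_inner_self_eq_norm_sq, hx, hy2, real_inner_comm x₀ y]
  simp
  field_simp
  ring

theorem boost_neg_boost {N : ℕ} (x₀ y : E N) : boost (-x₀) (boost x₀ y) = y := by
  have hp := height_pos x₀
  have hx := norm_sq_eq_height_sq_sub_one x₀
  have hn : height (-x₀) = height x₀ := by simp [height]
  have hne : 1 + height x₀ ≠ 0 := by positivity
  have hi : ⟪x₀, boost x₀ y⟫ = height y * (height x₀ ^ 2 - 1) + height x₀ * ⟪x₀, y⟫ := by
    simp only [boost, frame, inner_add_right, inner_smul_right, real_inner_self_eq_norm_sq, hx]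
    field_simp
    ring
  rw [boost, frame, height_boost, hn, inner_neg_left, hi, boost, frame]
  match_scalars
  · field_simp
    ring
  · ring

theorem boost_boost_neg {N : ℕ} (x₀ y : E N) : boost x₀ (boost (-x₀) y) = y := by
  simpa using boost_neg_boost (-x₀) y

theorem height_sinh_smul {N : ℕ} (r : ℝ) (σ : sphere (0 : E N) 1) :
    height (Real.sinh r • (σ : E N)) = Real.cosh r := by
  have hσ : ‖(σ : E N)‖ = 1 := norm_eq_of_mem_sphere σ
  rw [height, norm_smul, hσ, mul_one, Real.norm_eq_abs, sq_abs, ← Real.cosh_sq',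
    Real.sqrt_sq (Real.cosh_pos r).le]

theorem boost_sinh_smul {N : ℕ} (x₀ : E N) (r : ℝ) (σ : sphere (0 : E N) 1) :
    boost x₀ (Real.sinh r • (σ : E N)) = polar x₀ r σ := by
  rw [boost, height_sinh_smul, polar, frame, frame, inner_smul_right]
  module

theorem continuous_height {N : ℕ} : Continuous (height : E N → ℝ) := by
  unfold height
  fun_prop

theorem continuous_boost {N : ℕ} (x₀ : E N) : Continuous (boost x₀) := by
  have := continuous_height (N := N)
  unfold boost frame
  fun_prop

theorem hasFDerivAt_height {N : ℕ} (y : E N) :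
    HasFDerivAt (height : E N → ℝ) ((height y)⁻¹ • innerSL ℝ y) y := by
  have h := (((hasStrictFDerivAt_norm_sq y).hasFDerivAt.const_add 1)).sqrt
    (show 1 + ‖y‖ ^ 2 ≠ 0 by positivity)
  refine h.congr_fderiv ?_
  ext v
  simp [height]
  ring

/-- `frame x₀` as a continuous linear map. -/
def frameL {N : ℕ} (x₀ : E N) : E N →L[ℝ] E N :=
  LinearMap.toContinuousLinearMap
    (LinearMap.transvection ((1 + height x₀)⁻¹ • (innerSL ℝ x₀ : E N →L[ℝ] ℝ).toLinearMap) x₀)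

theorem frameL_apply {N : ℕ} (x₀ y : E N) : frameL x₀ y = frame x₀ y := by
  simp [frameL, frame, LinearMap.transvection.apply, div_eq_inv_mul]

theorem frame_self {N : ℕ} (x₀ : E N) : frame x₀ x₀ = height x₀ • x₀ := by
  have hp := height_pos x₀
  have hx := norm_sq_eq_height_sq_sub_one x₀
  rw [frame, real_inner_self_eq_norm_sq, hx]
  match_scalars
  field_simp
  ring

theorem det_frameL {N : ℕ} (x₀ : E N) : (frameL x₀).det = height x₀ := by
  have hp := height_pos x₀
  have hx := norm_sq_eq_height_sq_sub_one x₀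
  rw [ContinuousLinearMap.det, frameL, LinearMap.coe_toContinuousLinearMap,
    LinearMap.transvection.det]
  simp only [LinearMap.smul_apply, ContinuousLinearMap.coe_coe, innerSL_apply_apply,
    real_inner_self_eq_norm_sq, hx, smul_eq_mul]
  field_simp
  ring

/-- The derivative of the boost, as a product of two transvections. -/
def boostDeriv {N : ℕ} (x₀ y : E N) : E N →L[ℝ] E N :=
  frameL x₀ ∘L LinearMap.toContinuousLinearMap
    (LinearMap.transvection ((height y)⁻¹ • (innerSL ℝ y : E N →L[ℝ] ℝ).toLinearMap)
      ((height x₀)⁻¹ • x₀))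

theorem hasFDerivAt_boost {N : ℕ} (x₀ y : E N) :
    HasFDerivAt (boost x₀) (boostDeriv x₀ y) y := by
  have hp := (height_pos x₀).ne'
  have h := ((hasFDerivAt_height y).smul_const x₀).add (frameL x₀).hasFDerivAt
  have he : boost x₀ = fun y => height y • x₀ + frameL x₀ y := by
    ext1 y
    rw [boost, frameL_apply]
  rw [he]
  refine h.congr_fderiv ?_
  ext1 v
  simp only [boostDeriv, add_apply, ContinuousLinearMap.smulRight_apply,
    ContinuousLinearMap.comp_apply, LinearMap.coe_toContinuousLinearMap',
    LinearMap.transvection.apply, map_add, map_smul, frameL_apply, frame_self, smul_smul,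
    smul_apply, LinearMap.smul_apply, ContinuousLinearMap.coe_coe]
  rw [add_comm]
  congr 2
  field_simp

theorem det_boostDeriv {N : ℕ} (x₀ y : E N) :
    (boostDeriv x₀ y).det = height (boost x₀ y) / height y := by
  have hp := (height_pos x₀).ne'
  have hy := (height_pos y).ne'
  have h1 : (boostDeriv x₀ y).det = (frameL x₀).det * (1 + (height y)⁻¹ *
      ((height x₀)⁻¹ * ⟪y, x₀⟫)) := by
    rw [boostDeriv, ContinuousLinearMap.det, ContinuousLinearMap.toLinearMap_comp,
      LinearMap.det_comp]
    congr 1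
    rw [LinearMap.coe_toContinuousLinearMap, LinearMap.transvection.det]
    simp [mul_left_comm]
  rw [h1, det_frameL, height_boost, real_inner_comm]
  field_simp

theorem lintegral_vol {N : ℕ} {g : E N → ℝ≥0∞} (hg : Measurable g) :
    ∫⁻ x, g x ∂(vol N) = ∫⁻ x, ENNReal.ofReal (height x)⁻¹ * g x := by
  rw [vol, lintegral_withDensity_eq_lintegral_mul _ _ hg]
  · rfl
  · have := continuous_height (N := N)
    exact ENNReal.measurable_ofReal.comp this.measurable.inv

/-- Boosts are isometries of hyperbolic space, so they preserve the volume. -/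
theorem lintegral_vol_comp_boost {N : ℕ} (x₀ : E N) {g : E N → ℝ≥0∞} (hg : Measurable g) :
    ∫⁻ x, g x ∂(vol N) = ∫⁻ y, g (boost x₀ y) ∂(vol N) := by
  have hgb : Measurable fun y => g (boost x₀ y) := hg.comp (continuous_boost x₀).measurable
  have hinj : InjOn (boost x₀) univ := fun a _ b _ h => by
    rw [← boost_neg_boost x₀ a, h, boost_neg_boost]
  have hsurj : boost x₀ '' univ = univ := by
    rw [image_univ]
    exact Function.Surjective.range_eq fun z => ⟨_, boost_boost_neg x₀ z⟩
  have h := lintegral_image_eq_lintegral_abs_det_fderiv_mul (volume : Measure (E N))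
    MeasurableSet.univ (fun y _ => (hasFDerivAt_boost x₀ y).hasFDerivWithinAt) hinj
    (fun x => ENNReal.ofReal (height x)⁻¹ * g x)
  rw [hsurj, Measure.restrict_univ] at h
  rw [lintegral_vol hg, lintegral_vol hgb, h]
  refine lintegral_congr fun y => ?_
  have hb := height_pos (boost x₀ y)
  have hy := height_pos y
  rw [← mul_assoc, ← ENNReal.ofReal_mul (abs_nonneg _), det_boostDeriv, abs_of_pos (by positivity)]
  congr 2
  field_simp

theorem lintegral_euclidean_polar {N : ℕ} (hN : 0 < N) {g : E N → ℝ≥0∞} (hg : Measurable g) :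
    ∫⁻ x, g x = ∫⁻ s in Ioi (0 : ℝ), ENNReal.ofReal (s ^ (N - 1)) *
      ∫⁻ σ : sphere (0 : E N) 1, g (s • (σ : E N)) ∂(sphereMeasure N) := by
  have : Nonempty (Fin N) := ⟨⟨0, hN⟩⟩
  have hmp := (volume : Measure (E N)).measurePreserving_homeomorphUnitSphereProd
  have hmeas : Measurable fun p : sphere (0 : E N) 1 × Ioi (0 : ℝ) => g ((p.2 : ℝ) • (p.1 : E N)) :=
    hg.comp (by fun_prop : Continuous fun p : sphere (0 : E N) 1 × Ioi (0 : ℝ) =>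
      (p.2 : ℝ) • (p.1 : E N)).measurable
  have h1 : ∫⁻ x, g x = ∫⁻ x in ({0}ᶜ : Set (E N)), g x := by
    rw [restrict_compl_singleton]
  have hinner : Measurable fun s : ℝ =>
      ∫⁻ σ : sphere (0 : E N) 1, g (s • (σ : E N)) ∂(sphereMeasure N) := by
    refine Measurable.lintegral_prod_right' (f := fun p : ℝ × sphere (0 : E N) 1 =>
      g (p.1 • (p.2 : E N))) (hg.comp ?_)
    exact (by fun_prop : Continuous fun p : ℝ × sphere (0 : E N) 1 => p.1 • (p.2 : E N)).measurable
  rw [h1, ← lintegral_subtype_comap (measurableSet_singleton 0).compl]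
  have h2 := hmp.lintegral_comp_emb (Homeomorph.measurableEmbedding _)
    (fun p => g ((p.2 : ℝ) • (p.1 : E N)))
  have h3 : ∀ x : ({0}ᶜ : Set (E N)), ((homeomorphUnitSphereProd (E N) x).2 : ℝ) •
      ((homeomorphUnitSphereProd (E N) x).1 : E N) = x := fun x => by
    rw [← homeomorphUnitSphereProd_symm_apply_coe, Homeomorph.symm_apply_apply]
  simp only [h3] at h2
  have hinner' : Measurable fun s : Ioi (0 : ℝ) =>
      ∫⁻ σ : sphere (0 : E N) 1, g ((s : ℝ) • (σ : E N)) ∂(sphereMeasure N) :=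
    hinner.comp measurable_subtype_coe
  rw [h2, lintegral_prod_symm _ hmeas.aemeasurable, Measure.volumeIoiPow,
    lintegral_withDensity_eq_lintegral_mul _ _ hinner']
  · simp only [finrank_euclideanSpace_fin]
    exact lintegral_subtype_comap measurableSet_Ioi (fun s : ℝ => ENNReal.ofReal (s ^ (N - 1)) *
      ∫⁻ σ : sphere (0 : E N) 1, g (s • (σ : E N)) ∂(sphereMeasure N))
  · fun_prop

theorem image_sinh_Ioi : Real.sinh '' Ioi 0 = Ioi 0 := by
  ext s
  constructor
  · rintro ⟨r, hr, rfl⟩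
    exact Real.sinh_pos_iff.mpr hr
  · intro hs
    exact ⟨Real.arsinh s, Real.arsinh_pos_iff.mpr hs, Real.sinh_arsinh s⟩

theorem lintegral_vol_polar {N : ℕ} (hN : 0 < N) (x₀ : E N) {g : E N → ℝ≥0∞}
    (hg : Measurable g) :
    ∫⁻ x, g x ∂(vol N) = ∫⁻ r in Ioi (0 : ℝ), ENNReal.ofReal (Real.sinh r ^ (N - 1)) *
      ∫⁻ σ : sphere (0 : E N) 1, g (polar x₀ r σ) ∂(sphereMeasure N) := by
  have hb := (continuous_boost x₀).measurable
  have hh := (continuous_height (N := N)).measurable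
  have hgb : Measurable fun y => g (boost x₀ y) := hg.comp hb
  rw [lintegral_vol_comp_boost x₀ hg, lintegral_vol hgb, lintegral_euclidean_polar hN]
  · conv_lhs =>
      rw [← image_sinh_Ioi, lintegral_image_eq_lintegral_abs_deriv_mul measurableSet_Ioi
        (fun r _ => (Real.hasDerivAt_sinh r).hasDerivWithinAt) Real.sinh_injective.injOn]
    refine lintegral_congr fun r => ?_
    simp only [height_sinh_smul, boost_sinh_smul]
    rw [lintegral_const_mul' _ _ ENNReal.ofReal_ne_top, mul_left_comm,
      ← mul_assoc (ENNReal.ofReal |_|), ← ENNReal.ofReal_mul (abs_nonneg _),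
      abs_of_pos (Real.cosh_pos r),
      mul_inv_cancel₀ (Real.cosh_pos r).ne', ENNReal.ofReal_one, one_mul]
  · exact (ENNReal.measurable_ofReal.comp hh.inv).mul hgb

/-- The radial part `sinh^{N-1} r dr` of the hyperbolic volume, a measure on `(0, ∞)`. -/
def radialMeasure (N : ℕ) : Measure ℝ :=
  (volume.restrict (Ioi 0)).withDensity fun r => ENNReal.ofReal (Real.sinh r ^ (N - 1))

instance (N : ℕ) : SFinite (radialMeasure N) := by
  unfold radialMeasure
  infer_instance

theorem continuous_polar {N : ℕ} (x₀ : E N) :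
    Continuous fun p : ℝ × E N => polar x₀ p.1 p.2 := by
  unfold polar frame
  fun_prop

theorem continuous_polar_sphere {N : ℕ} (x₀ : E N) :
    Continuous fun p : ℝ × sphere (0 : E N) 1 => polar x₀ p.1 p.2 :=
  (continuous_polar x₀).comp (g := fun p : ℝ × E N => polar x₀ p.1 p.2)
    (f := fun p : ℝ × sphere (0 : E N) 1 => (p.1, (p.2 : E N))) (by fun_prop)

/-- The hyperbolic volume in geodesic polar coordinates. -/
theorem measurePreserving_polar {N : ℕ} (hN : 0 < N) (x₀ : E N) :
    MeasurePreserving (fun p : ℝ × sphere (0 : E N) 1 => polar x₀ p.1 p.2)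
      ((radialMeasure N).prod (sphereMeasure N)) (vol N) := by
  have hm := (continuous_polar_sphere x₀).measurable
  refine ⟨hm, Measure.ext fun s hs => ?_⟩
  have hind : Measurable (s.indicator (1 : E N → ℝ≥0∞)) := measurable_one.indicator hs
  have hF : Measurable fun p : ℝ × sphere (0 : E N) 1 =>
      s.indicator (1 : E N → ℝ≥0∞) (polar x₀ p.1 p.2) := hind.comp hm
  have hd : Measurable fun r : ℝ => ENNReal.ofReal (Real.sinh r ^ (N - 1)) := by fun_prop
  rw [← lintegral_indicator_one hs, ← lintegral_indicator_one hs, lintegral_map hind hm,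
    lintegral_prod _ hF.aemeasurable, radialMeasure,
    lintegral_withDensity_eq_lintegral_mul _ hd hF.lintegral_prod_right',
    lintegral_vol_polar hN x₀ hind]
  rfl

/-! ### The gradient and the distance in polar coordinates -/

theorem one_le_height {N : ℕ} (x : E N) : 1 ≤ height x :=
  Real.le_sqrt_of_sq_le (by nlinarith [sq_nonneg ‖x‖])

theorem continuous_hdist {N : ℕ} (x₀ : E N) : Continuous (hdist x₀) := by
  have hh := continuous_height (N := N)
  refine Real.continuousOn_arcosh.comp_continuous (by fun_prop) fun x => ?_
  have h := one_le_height (boost (-x₀) x)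
  have hn : height (-x₀) = height x₀ := by simp [height]
  rw [height_boost, hn, inner_neg_left] at h
  simpa [sub_eq_add_neg] using h

theorem exists_polar_eq {N : ℕ} {x₀ x : E N} (hx : x ≠ x₀) :
    ∃ r, 0 < r ∧ ∃ σ : sphere (0 : E N) 1, polar x₀ r σ = x := by
  set y := boost (-x₀) x with hy
  have hxy : boost x₀ y = x := boost_boost_neg x₀ x
  have hy0 : y ≠ 0 := by
    intro h
    rw [h] at hxy
    exact hx (by simpa [boost, frame, height] using hxy.symm)
  have hn : 0 < ‖y‖ := norm_pos_iff.mpr hy0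
  refine ⟨Real.arsinh ‖y‖, Real.arsinh_pos_iff.mpr hn, ⟨‖y‖⁻¹ • y, ?_⟩, ?_⟩
  · simp [norm_smul, hn.ne']
  · rw [← boost_sinh_smul, Real.sinh_arsinh, smul_smul, mul_inv_cancel₀ hn.ne', one_smul, hxy]

theorem hdist_pos {N : ℕ} {x₀ x : E N} (hx : x ≠ x₀) : 0 < hdist x₀ x := by
  obtain ⟨r, hr, σ, rfl⟩ := exists_polar_eq hx
  rwa [hdist_polar x₀ hr.le]

theorem fderiv_eq_inner_gradient {N : ℕ} (u : E N → ℝ) (x v : E N) :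
    fderiv ℝ u x v = ⟪gradient u x, v⟫ := by
  simp [gradient]

theorem gradSq_eq {N : ℕ} (u : E N → ℝ) (x : E N) :
    gradSq u x = ‖gradient u x‖ ^ 2 + ⟪x, gradient u x⟫ ^ 2 := by
  rw [gradSq, metric_grad, fderiv_eq_inner_gradient, grad, inner_add_right, inner_smul_right,
    real_inner_self_eq_norm_sq, real_inner_comm x]
  ring

theorem inner_frame_left {N : ℕ} (x₀ a b : E N) : ⟪frame x₀ a, b⟫ = ⟪a, frame x₀ b⟫ := by
  simp only [frame, inner_add_left, inner_add_right, inner_smul_left, inner_smul_right,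
    RCLike.conj_to_real]
  rw [real_inner_comm x₀ a]
  ring

theorem norm_frame_sq {N : ℕ} (x₀ a : E N) : ‖frame x₀ a‖ ^ 2 = ‖a‖ ^ 2 + ⟪x₀, a⟫ ^ 2 := by
  have hp := height_pos x₀
  have hx := norm_sq_eq_height_sq_sub_one x₀
  rw [← real_inner_self_eq_norm_sq]
  simp only [frame, inner_add_left, inner_add_right, inner_smul_left, inner_smul_right,
    RCLike.conj_to_real, real_inner_self_eq_norm_sq, hx, real_inner_comm x₀ a]
  field_simp
  ring

/-- Lagrange's identity. -/
theorem half_sum_sq_sub {N : ℕ} (a b : E N) :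
    (1 / 2) * ∑ i, ∑ k, (a i * b k - a k * b i) ^ 2 = ‖a‖ ^ 2 * ‖b‖ ^ 2 - ⟪a, b⟫ ^ 2 := by
  have h : ∀ i k, (a i * b k - a k * b i) ^ 2 =
      a i ^ 2 * b k ^ 2 + b i ^ 2 * a k ^ 2 - 2 * ((a i * b i) * (a k * b k)) := fun i k => by ring
  have hi : ⟪a, b⟫ = ∑ i, a i * b i := by
    simp [PiLp.inner_apply, mul_comm]
  rw [hi, EuclideanSpace.real_norm_sq_eq, EuclideanSpace.real_norm_sq_eq]
  simp only [h, Finset.sum_add_distrib, Finset.sum_sub_distrib, ← Finset.mul_sum,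
    ← Finset.sum_mul]
  ring

/-- The function `y ↦ u(r, y)` of the direction in polar coordinates, extended from the unit sphere
to `ℝ^N` by the formula for `polar`. -/
def sliceFun {N : ℕ} (x₀ : E N) (u : C(E N, ℝ)) (r : ℝ) : C(E N, ℝ) :=
  ⟨fun y => u (polar x₀ r y), by
    refine u.continuous.comp ?_
    unfold polar frame
    fun_prop⟩

theorem polar_eq_frameL {N : ℕ} (x₀ : E N) (r : ℝ) :
    polar x₀ r = fun y => Real.cosh r • x₀ + Real.sinh r • frameL x₀ y := by
  ext1 y
  rw [polar, frameL_apply]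

theorem contDiff_sliceFun {N : ℕ} (x₀ : E N) {u : C(E N, ℝ)} (hu : ContDiff ℝ ∞ u) (r : ℝ) :
    ContDiff ℝ ∞ (sliceFun x₀ u r) := by
  refine hu.comp (g := u) (f := polar x₀ r) ?_
  rw [polar_eq_frameL]
  exact contDiff_const.add ((frameL x₀).contDiff.const_smul _)

theorem fderiv_sliceFun {N : ℕ} (x₀ : E N) {u : C(E N, ℝ)} (hu : ContDiff ℝ ∞ u) (r : ℝ)
    (y v : E N) :
    fderiv ℝ (sliceFun x₀ u r) y v =
      Real.sinh r * ⟪frame x₀ (gradient u (polar x₀ r y)), v⟫ := by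
  have h1 : HasFDerivAt (polar x₀ r) (Real.sinh r • frameL x₀) y := by
    rw [polar_eq_frameL]
    exact ((frameL x₀).hasFDerivAt.const_smul (Real.sinh r)).const_add (Real.cosh r • x₀)
  have h2 : HasFDerivAt (sliceFun x₀ u r)
      ((fderiv ℝ u (polar x₀ r y)).comp (Real.sinh r • frameL x₀)) y :=
    (hu.differentiable (by simp) _).hasFDerivAt.comp y h1
  rw [h2.fderiv, inner_frame_left, ContinuousLinearMap.comp_apply, fderiv_eq_inner_gradient,
    smul_apply, frameL_apply, inner_smul_right]

theorem sphereGradSq_sliceFun {N : ℕ} (x₀ : E N) {u : C(E N, ℝ)} (hu : ContDiff ℝ ∞ u) (r : ℝ)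
    (σ : sphere (0 : E N) 1) :
    sphereGradSq (sliceFun x₀ u r) σ = Real.sinh r ^ 2 *
      (‖frame x₀ (gradient u (polar x₀ r σ))‖ ^ 2 -
        ⟪(σ : E N), frame x₀ (gradient u (polar x₀ r σ))⟫ ^ 2) := by
  have hσ : ‖(σ : E N)‖ = 1 := norm_eq_of_mem_sphere σ
  have h := half_sum_sq_sub (σ : E N) (frame x₀ (gradient u (polar x₀ r σ)))
  rw [hσ, one_pow, one_mul] at h
  rw [← h, sphereGradSq, mul_left_comm]
  congr 1
  rw [Finset.mul_sum]
  refine Finset.sum_congr rfl fun i _ => ?_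
  rw [Finset.mul_sum]
  refine Finset.sum_congr rfl fun k _ => ?_
  simp only [rot, fderiv_sliceFun x₀ hu, rotField, inner_sub_right, inner_smul_right,
    EuclideanSpace.inner_single_right]
  simp
  ring

theorem radialDir_polar {N : ℕ} (x₀ : E N) {r : ℝ} (hr : 0 < r) (σ : sphere (0 : E N) 1) :
    radialDir x₀ (polar x₀ r σ) = Real.sinh r • x₀ + Real.cosh r • frame x₀ (σ : E N) :=
  (hasDerivAt_polar x₀ hr σ).unique (((Real.hasDerivAt_cosh r).smul_const x₀).add
    ((Real.hasDerivAt_sinh r).smul_const (frame x₀ (σ : E N))))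

/-- The gradient splits orthogonally into its radial and its spherical part. -/
theorem gradSq_polar {N : ℕ} (x₀ : E N) {u : C(E N, ℝ)} (hu : ContDiff ℝ ∞ u) {r : ℝ}
    (hr : 0 < r) (σ : sphere (0 : E N) 1) :
    gradSq u (polar x₀ r σ) = radialDeriv x₀ u (polar x₀ r σ) ^ 2 +
      sphereGradSq (sliceFun x₀ u r) σ / Real.sinh r ^ 2 := by
  have hs : Real.sinh r ≠ 0 := (Real.sinh_pos_iff.mpr hr).ne'
  have hc := Real.cosh_sq r
  rw [sphereGradSq_sliceFun x₀ hu, mul_div_cancel_left₀ _ (pow_ne_zero 2 hs), norm_frame_sq,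
    radialDeriv, radialDir_polar x₀ hr, fderiv_eq_inner_gradient, gradSq_eq,
    ← inner_frame_left]
  generalize gradient u (polar x₀ r σ) = g
  simp only [polar, inner_add_left, inner_add_right, inner_smul_left, inner_smul_right,
    RCLike.conj_to_real, real_inner_comm x₀ g, real_inner_comm (frame x₀ (σ : E N)) g]
  linear_combination (⟪x₀, g⟫ ^ 2 - ⟪frame x₀ (σ : E N), g⟫ ^ 2) * hc

/-! ### Integration of radially weighted functions -/

theorem quasiMeasurePreserving_hdist {N : ℕ} (hN : 0 < N) (x₀ : E N) :
    Measure.QuasiMeasurePreserving (hdist x₀) (vol N) volume := by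
  have hd := (continuous_hdist x₀).measurable
  refine ⟨hd, Measure.AbsolutelyContinuous.mk fun A hA h0 => ?_⟩
  have hmp := measurePreserving_polar hN x₀
  rw [Measure.map_apply hd hA, ← hmp.measure_preimage (hd hA).nullMeasurableSet]
  have hr0 : radialMeasure N A = 0 :=
    (withDensity_absolutelyContinuous _ _) (Measure.restrict_le_self.absolutelyContinuous h0)
  have hrpos : radialMeasure N (Ioi 0)ᶜ = 0 := by
    refine (withDensity_absolutelyContinuous _ _) ?_
    rw [Measure.restrict_apply measurableSet_Ioi.compl, compl_inter_self, measure_empty]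
  have hq : Measure.QuasiMeasurePreserving Prod.fst
      ((radialMeasure N).prod (sphereMeasure N)) (radialMeasure N) :=
    Measure.quasiMeasurePreserving_fst
  refine measure_mono_null (t := Prod.fst ⁻¹' A ∪ Prod.fst ⁻¹' (Ioi 0)ᶜ) ?_
    (measure_union_null (hq.preimage_null hr0) (hq.preimage_null hrpos))
  rintro ⟨r, σ⟩ h
  by_cases hr : 0 < r
  · left
    simpa [hdist_polar x₀ hr.le] using h
  · right
    simpa using hr

theorem ae_radialMeasure_pos (N : ℕ) : ∀ᵐ r ∂(radialMeasure N), 0 < r :=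
  (withDensity_absolutelyContinuous _ _).ae_le (ae_restrict_mem measurableSet_Ioi)

theorem integrable_radialMeasure_iff {N : ℕ} {g : ℝ → ℝ} :
    Integrable g (radialMeasure N) ↔
      IntegrableOn (fun r => g r * Real.sinh r ^ (N - 1)) (Ioi 0) := by
  rw [radialMeasure, integrable_withDensity_iff_integrable_smul' (by fun_prop) (by simp)]
  refine integrable_congr ?_
  filter_upwards [ae_restrict_mem measurableSet_Ioi] with r hr
  rw [ENNReal.toReal_ofReal (pow_nonneg (Real.sinh_nonneg_iff.mpr (le_of_lt hr)) _), smul_eq_mul,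
    mul_comm]

theorem integral_radialMeasure {N : ℕ} (g : ℝ → ℝ) :
    ∫ r, g r ∂(radialMeasure N) = ∫ r in Ioi 0, g r * Real.sinh r ^ (N - 1) := by
  rw [radialMeasure, integral_withDensity_eq_integral_toReal_smul (by fun_prop) (by simp)]
  refine integral_congr_ae ?_
  filter_upwards [ae_restrict_mem measurableSet_Ioi] with r hr
  rw [ENNReal.toReal_ofReal (pow_nonneg (Real.sinh_nonneg_iff.mpr (le_of_lt hr)) _), smul_eq_mul,
    mul_comm]

theorem hdist_image_subset_radii {N : ℕ} {x₀ : E N} {R : ℝ≥0∞} {K : Set (E N)}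
    (hK : K ⊆ hball x₀ R \ {x₀}) : hdist x₀ '' K ⊆ radii R := by
  rintro _ ⟨x, hx, rfl⟩
  exact ⟨hdist_pos (hK hx).2, (hK hx).1⟩

theorem measurableSet_radii (R : ℝ≥0∞) : MeasurableSet (radii R) :=
  measurableSet_Ioi.inter (measurableSet_lt ENNReal.measurable_ofReal measurable_const)

theorem integrableOn_mul_of_continuousOn {R : ℝ≥0∞} {V : ℝ → ℝ}
    (hV : LocallyIntegrableOn V (radii R)) {K : Set ℝ} (hK : IsCompact K) (hKR : K ⊆ radii R)
    {g : ℝ → ℝ} (hg : ContinuousOn g (Ioi 0)) (hg0 : ∀ r ∈ radii R, r ∉ K → g r = 0) :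
    IntegrableOn (fun r => V r * g r) (radii R) := by
  have h := (hV.integrableOn_compact_subset hKR hK).mul_continuousOn
    (hg.mono fun r hr => (hKR hr).1) hK
  exact h.of_forall_sdiff_eq_zero (measurableSet_radii R) fun r hr => by
    rw [hg0 r hr.1 hr.2, mul_zero]

/-- Integration in polar coordinates of `V(r) G`, where `V` is locally integrable and `G` is
continuous with compact support away from the pole. -/
theorem integral_hdist_mul {N : ℕ} (hN : 0 < N) (x₀ : E N) {R : ℝ≥0∞} {V : ℝ → ℝ}
    (hV : LocallyIntegrableOn V (radii R)) {K : Set (E N)} (hK : IsCompact K)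
    (hKR : K ⊆ hball x₀ R \ {x₀}) {G : E N → ℝ} (hG : Continuous G) (hG0 : ∀ x ∉ K, G x = 0) :
    IntegrableOn (fun x => V (hdist x₀ x) * G x) (hball x₀ R) (vol N) ∧
    IntegrableOn (fun r => V r * (∫ σ : sphere (0 : E N) 1, G (polar x₀ r σ) ∂(sphereMeasure N)) *
      Real.sinh r ^ (N - 1)) (radii R) ∧
    ∫ x in hball x₀ R, V (hdist x₀ x) * G x ∂(vol N) =
      ∫ r in radii R, V r * (∫ σ : sphere (0 : E N) 1, G (polar x₀ r σ) ∂(sphereMeasure N)) *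
        Real.sinh r ^ (N - 1) := by
  have hmp := measurePreserving_polar hN x₀
  have hΦ := continuous_polar_sphere x₀
  -- On the compact set `K' ⊆ (0, R)` of relevant radii the weight is integrable.
  set K' := hdist x₀ '' K with hK'
  have hK'c : IsCompact K' := hK.image (continuous_hdist x₀)
  have hK'R : K' ⊆ radii R := hdist_image_subset_radii hKR
  set W := K'.indicator V with hW
  have hWi : Integrable W :=
    (integrable_indicator_iff hK'c.measurableSet).mpr (hV.integrableOn_compact_subset hK'R hK'c)
  have hWr : Integrable W (radialMeasure N) := by
    rw [integrable_radialMeasure_iff]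
    have h := (hV.integrableOn_compact_subset hK'R hK'c).mul_continuousOn
      (g' := fun r => Real.sinh r ^ (N - 1)) (by fun_prop) hK'c
    have h' := (integrable_indicator_iff hK'c.measurableSet).mpr h
    refine (h'.congr (Filter.Eventually.of_forall fun r => ?_)).integrableOn
    by_cases hr : r ∈ K' <;> simp [hW, hr]
  have hF : (fun x => V (hdist x₀ x) * G x) = fun x => W (hdist x₀ x) * G x := by
    ext x
    by_cases hx : x ∈ K
    · rw [hW, indicator_of_mem (mem_image_of_mem _ hx)]
    · rw [hG0 x hx, mul_zero, mul_zero]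
  obtain ⟨M, hM⟩ := hK.exists_bound_of_continuousOn hG.continuousOn
  have hMG : ∀ x, ‖G x‖ ≤ max M 0 := fun x => by
    by_cases hx : x ∈ K
    · exact (hM x hx).trans (le_max_left _ _)
    · simp [hG0 x hx]
  have hprod : Integrable (fun p : ℝ × sphere (0 : E N) 1 => W p.1 * G (polar x₀ p.1 p.2))
      ((radialMeasure N).prod (sphereMeasure N)) :=
    (hWr.comp_fst (sphereMeasure N)).mul_bdd (hG.comp hΦ).aestronglyMeasurable
      (Filter.Eventually.of_forall fun p => hMG _)
  have hae : (fun p : ℝ × sphere (0 : E N) 1 => W p.1 * G (polar x₀ p.1 p.2)) =ᵐ[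
      (radialMeasure N).prod (sphereMeasure N)] fun p =>
      W (hdist x₀ (polar x₀ p.1 p.2)) * G (polar x₀ p.1 p.2) := by
    filter_upwards [Measure.quasiMeasurePreserving_fst.ae (ae_radialMeasure_pos N)] with p hp
    rw [hdist_polar x₀ (le_of_lt hp)]
  have hmeas : AEStronglyMeasurable (fun x => W (hdist x₀ x) * G x) (vol N) :=
    (hWi.aestronglyMeasurable.comp_quasiMeasurePreserving
      (quasiMeasurePreserving_hdist hN x₀)).mul hG.aestronglyMeasurable
  have hint : Integrable (fun x => W (hdist x₀ x) * G x) (vol N) := by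
    rw [← hmp.integrable_comp hmeas]
    exact hprod.congr hae
  have hcompl : ∀ x ∉ hball x₀ R, W (hdist x₀ x) * G x = 0 := fun x hx => by
    rw [hG0 x fun h => hx (hKR h).1, mul_zero]
  have hrad : ∀ r ∈ Ioi (0 : ℝ), r ∉ K' →
      ∫ σ : sphere (0 : E N) 1, G (polar x₀ r σ) ∂(sphereMeasure N) = 0 := fun r hr hrK => by
    refine integral_eq_zero_of_ae (Filter.Eventually.of_forall fun σ => hG0 _ fun h => hrK ?_)
    exact ⟨_, h, hdist_polar x₀ (le_of_lt hr) σ⟩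
  have hWV : ∀ r ∈ Ioi (0 : ℝ),
      W r * ∫ σ : sphere (0 : E N) 1, G (polar x₀ r σ) ∂(sphereMeasure N) =
        V r * ∫ σ : sphere (0 : E N) 1, G (polar x₀ r σ) ∂(sphereMeasure N) := fun r hr => by
    by_cases hrK : r ∈ K'
    · rw [hW, indicator_of_mem hrK]
    · rw [hrad r hr hrK, mul_zero, mul_zero]
  have hint1 : IntegrableOn (fun r => V r *
      (∫ σ : sphere (0 : E N) 1, G (polar x₀ r σ) ∂(sphereMeasure N)) *
      Real.sinh r ^ (N - 1)) (Ioi 0) := by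
    have h := hprod.integral_prod_left
    simp only [integral_const_mul] at h
    rw [integrable_radialMeasure_iff] at h
    exact h.congr_fun (fun r hr => by simp only [hWV r hr]) measurableSet_Ioi
  have hsub : radii R ⊆ Ioi 0 := fun r hr => hr.1
  rw [hF]
  refine ⟨hint.integrableOn, hint1.mono_set hsub, ?_⟩
  rw [setIntegral_eq_integral_of_forall_compl_eq_zero hcompl, ← hmp.map_eq,
    integral_map hmp.aemeasurable (by rwa [hmp.map_eq]), ← integral_congr_ae hae,
    integral_prod _ hprod]
  simp only [integral_const_mul]
  have hcongr : ∫ r in Ioi 0, W r *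
        (∫ σ : sphere (0 : E N) 1, G (polar x₀ r σ) ∂(sphereMeasure N)) * Real.sinh r ^ (N - 1) =
      ∫ r in Ioi 0, V r *
        (∫ σ : sphere (0 : E N) 1, G (polar x₀ r σ) ∂(sphereMeasure N)) * Real.sinh r ^ (N - 1) :=
    setIntegral_congr_fun measurableSet_Ioi fun r hr =>
      congrArg (· * Real.sinh r ^ (N - 1)) (hWV r hr)
  rw [integral_radialMeasure, hcongr]
  refine setIntegral_eq_of_subset_of_forall_sdiff_eq_zero measurableSet_Ioi hsub fun r hr => ?_
  rw [hrad r hr.1 fun h => hr.2 (hK'R h), mul_zero, zero_mul]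

/-! ### Slices of a test function -/

theorem slice_eq_sphereLp {N : ℕ} (x₀ : E N) (u : C(E N, ℝ)) (r : ℝ) :
    slice x₀ u r = sphereLp (sliceFun x₀ u r) := by
  have hm : MemLp (fun σ : sphere (0 : E N) 1 => u (polar x₀ r σ)) 2 (sphereMeasure N) :=
    ((sliceFun x₀ u r).restrict (sphere 0 1)).continuous.memLp_of_hasCompactSupport
      (HasCompactSupport.of_compactSpace _)
  rw [slice, dif_pos hm]
  refine Lp.ext ?_
  refine hm.coeFn_toLp.trans ?_
  exact (ContinuousMap.coeFn_toLp (sphereMeasure N) (𝕜 := ℝ) (p := 2)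
    ((sliceFun x₀ u r).restrict (sphere 0 1))).symm

theorem continuous_slice {N : ℕ} (x₀ : E N) (u : C(E N, ℝ)) : Continuous (slice x₀ u) := by
  let U : C(ℝ × sphere (0 : E N) 1, ℝ) := u.comp ⟨_, continuous_polar_sphere x₀⟩
  have h : slice x₀ u = fun r =>
      ContinuousMap.toLp (E := ℝ) 2 (sphereMeasure N) ℝ (U.curry r) := by
    ext1 r
    rw [slice_eq_sphereLp]
    rfl
  rw [h]
  exact (ContinuousMap.toLp (E := ℝ) 2 (sphereMeasure N) ℝ).continuous.comp U.curry.continuous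

theorem continuous_component {N : ℕ} (x₀ : E N) (u : C(E N, ℝ)) (n : ℕ) :
    Continuous (component x₀ u n) :=
  (sphericalHarmonics N n).starProjection.continuous.comp (continuous_slice x₀ u)

theorem slice_eq_zero {N : ℕ} {x₀ : E N} {u : C(E N, ℝ)} {r : ℝ} (hr : 0 < r)
    (h : r ∉ hdist x₀ '' tsupport u) : slice x₀ u r = 0 := by
  have hz : (sliceFun x₀ u r).restrict (sphere 0 1) = 0 := by
    ext σ
    refine image_eq_zero_of_notMem_tsupport (f := u) (x := polar x₀ r σ) fun hσ => h ?_
    exact ⟨_, hσ, hdist_polar x₀ hr.le σ⟩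
  rw [slice_eq_sphereLp, sphereLp, hz, map_zero]

theorem continuous_of_continuousOn_compl_singleton {X : Type*} [TopologicalSpace X] [T1Space X]
    {f : X → ℝ} {a : X} {K : Set X} (hf : ContinuousOn f {a}ᶜ) (hK : IsClosed K)
    (ha : a ∉ K) (hf0 : ∀ x ∉ K, f x = 0) : Continuous f := by
  refine continuous_iff_continuousAt.mpr fun x => ?_
  by_cases hx : x = a
  · subst hx
    refine continuousAt_const.congr (f := fun _ => (0 : ℝ)) ?_
    filter_upwards [hK.isOpen_compl.mem_nhds ha] with y hy
    exact (hf0 y hy).symm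
  · exact hf.continuousAt (isOpen_compl_singleton.mem_nhds hx)

theorem continuous_gradSq {N : ℕ} {u : C(E N, ℝ)} (hu : ContDiff ℝ ∞ u) :
    Continuous (gradSq u) := by
  have hg : Continuous (gradient (u : E N → ℝ)) :=
    (InnerProductSpace.toDual ℝ (E N)).symm.continuous.comp (hu.continuous_fderiv (by simp))
  have h : gradSq u = fun x => ‖gradient u x‖ ^ 2 + ⟪x, gradient u x⟫ ^ 2 :=
    funext (gradSq_eq u)
  rw [h]
  fun_prop

theorem gradSq_eq_zero {N : ℕ} {u : E N → ℝ} {x : E N} (hx : x ∉ tsupport u) :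
    gradSq u x = 0 := by
  rw [gradSq, metric_grad, fderiv_of_notMem_tsupport ℝ hx, zero_apply]

theorem radialDeriv_eq_zero {N : ℕ} (x₀ : E N) {u : E N → ℝ} {x : E N} (hx : x ∉ tsupport u) :
    radialDeriv x₀ u x = 0 := by
  rw [radialDeriv, fderiv_of_notMem_tsupport ℝ hx, zero_apply]

theorem sinh_hdist_ne_zero {N : ℕ} {x₀ x : E N} (hx : x ≠ x₀) : Real.sinh (hdist x₀ x) ≠ 0 :=
  (Real.sinh_pos_iff.mpr (hdist_pos hx)).ne'

theorem continuous_radialDeriv {N : ℕ} {x₀ : E N} {u : C(E N, ℝ)} (hu : ContDiff ℝ ∞ u)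
    (hx₀ : x₀ ∉ tsupport u) : Continuous (radialDeriv x₀ u) := by
  refine continuous_of_continuousOn_compl_singleton (a := x₀) ?_ (isClosed_tsupport u) hx₀
    fun x hx => radialDeriv_eq_zero x₀ hx
  have hd := continuous_hdist x₀
  refine (hu.continuous_fderiv (by simp)).continuousOn.clm_apply ?_
  refine ContinuousOn.smul (ContinuousOn.inv₀ (by fun_prop) fun x hx => sinh_hdist_ne_zero hx) ?_
  fun_prop

theorem continuous_sq_div_sinh_sq {N : ℕ} {x₀ : E N} {u : C(E N, ℝ)} (hx₀ : x₀ ∉ tsupport u) :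
    Continuous fun x => u x ^ 2 / Real.sinh (hdist x₀ x) ^ 2 := by
  refine continuous_of_continuousOn_compl_singleton (a := x₀) ?_ (isClosed_tsupport u) hx₀
    fun x hx => by simp [image_eq_zero_of_notMem_tsupport hx]
  have hd := continuous_hdist x₀
  exact ContinuousOn.div (by fun_prop) (by fun_prop) fun x hx =>
    pow_ne_zero 2 (sinh_hdist_ne_zero hx)

theorem sphereEigenvalue_sub (N n : ℕ) (j : ℤ) :
    sphereEigenvalue N n - ((j : ℝ) + 1) * ((N : ℝ) + j - 1) =
      ((n : ℝ) - j - 1) * ((N : ℝ) + n + j - 1) := by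
  rw [sphereEigenvalue]
  ring

/-- The identity on a single sphere: for a slice without components of order at most `j`, the
Dirichlet integral exceeds `(j + 1)(N + j - 1)` times the squared `L²` norm by a combination of the
remaining components, with coefficients that are differences of eigenvalues. -/
theorem hasSum_slice {N : ℕ} (hN : 2 ≤ N) (x₀ : E N) {u : C(E N, ℝ)} (hu : ContDiff ℝ ∞ u)
    (j : ℤ) {r : ℝ} (h0 : ∀ n : ℕ, (n : ℤ) ≤ j → component x₀ u n r = 0) :
    HasSum (fun n : {n : ℕ // j + 1 ≤ (n : ℤ)} =>
        ((n : ℝ) - j - 1) * ((N : ℝ) + (n : ℝ) + j - 1) * ‖component x₀ u n r‖ ^ 2)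
      ((∫ σ : sphere (0 : E N) 1, sphereGradSq (sliceFun x₀ u r) σ ∂(sphereMeasure N)) -
        ((j : ℝ) + 1) * ((N : ℝ) + j - 1) *
          ∫ σ : sphere (0 : E N) 1, u (polar x₀ r σ) ^ 2 ∂(sphereMeasure N)) := by
  have hc : ∀ n, component x₀ u n r =
      (sphericalHarmonics N n).starProjection (sphereLp (sliceFun x₀ u r)) := fun n => by
    rw [component, slice_eq_sphereLp]
  have h1 := hasSum_sphereEigenvalue_mul_norm_sq hN (contDiff_sliceFun x₀ hu r)
  have h2 := (hasSum_norm_sq_starProjection hN (sliceFun x₀ u r)).mul_left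
    (((j : ℝ) + 1) * ((N : ℝ) + j - 1))
  have h := h1.sub h2
  simp only [← hc, ← sub_mul, sphereEigenvalue_sub] at h
  refine (hasSum_subtype_iff_of_support_subset (s := {n : ℕ | j + 1 ≤ (n : ℤ)}) ?_).mpr h
  intro n hn
  by_contra hnj
  refine hn ?_
  have : (n : ℤ) ≤ j := by
    rw [mem_ofPred_eq] at hnj
    omega
  simp [h0 n this]

theorem integral_gradSq_sub {N : ℕ} (x₀ : E N) {u : C(E N, ℝ)} (hu : ContDiff ℝ ∞ u)
    (hx₀ : x₀ ∉ tsupport u) {r : ℝ} (hr : 0 < r) :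
    (∫ σ : sphere (0 : E N) 1, gradSq u (polar x₀ r σ) ∂(sphereMeasure N)) -
        ∫ σ : sphere (0 : E N) 1, radialDeriv x₀ u (polar x₀ r σ) ^ 2 ∂(sphereMeasure N) =
      (∫ σ : sphere (0 : E N) 1, sphereGradSq (sliceFun x₀ u r) σ ∂(sphereMeasure N)) /
        Real.sinh r ^ 2 := by
  have hp : Continuous (polar x₀ r) := by
    unfold polar frame
    fun_prop
  rw [← integral_sub, ← integral_div]
  · congr 1
    ext σ
    rw [gradSq_polar x₀ hu hr]
    ring
  · exact integrable_sphere (f := fun y => gradSq u (polar x₀ r y))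
      ((continuous_gradSq hu).comp hp)
  · exact integrable_sphere (f := fun y => radialDeriv x₀ u (polar x₀ r y) ^ 2)
      (((continuous_radialDeriv hu hx₀).comp hp).pow 2)

theorem sinh_pow_div_sq {N : ℕ} (hN : 1 ≤ N) {r : ℝ} (hr : 0 < r) :
    Real.sinh r ^ (N - 1) / Real.sinh r ^ 2 = Real.sinh r ^ ((N : ℤ) - 3) := by
  have hs : Real.sinh r ≠ 0 := (Real.sinh_pos_iff.mpr hr).ne'
  rw [← zpow_natCast, ← zpow_natCast, ← zpow_sub₀ hs]
  congr 1
  push_cast [Nat.cast_sub hN]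
  ring

end Hyp

end

open MeasureTheory Set Hyp
open scoped ENNReal

theorem theorem2p2 (N : ℕ) (hN : 2 ≤ N) (x₀ : Hyp.E N) (R : ℝ≥0∞) (hR : 0 < R)
    (V : ℝ → ℝ) (hV : LocallyIntegrableOn V (radii R)) (j : ℤ) (hj : -1 ≤ j)
    (u : Hyp.E N → ℝ) (hu : u ∈ subspaceH x₀ j (hball x₀ R \ {x₀})) :
    IntegrableOn (fun x => V (hdist x₀ x) * gradSq u x) (hball x₀ R) (vol N) ∧
    IntegrableOn (fun x => V (hdist x₀ x) * radialDeriv x₀ u x ^ 2) (hball x₀ R) (vol N) ∧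
    IntegrableOn (fun x => V (hdist x₀ x) * u x ^ 2 / Real.sinh (hdist x₀ x) ^ 2)
      (hball x₀ R) (vol N) ∧
    (∀ n : ℕ, IntegrableOn
      (fun r => V r * ‖component x₀ u n r‖ ^ 2 * Real.sinh r ^ ((N : ℤ) - 3)) (radii R)) ∧
    HasSum
      (fun n : {n : ℕ // j + 1 ≤ (n : ℤ)} =>
        ((n : ℝ) - j - 1) * ((N : ℝ) + (n : ℝ) + j - 1) *
          ∫ r in radii R, V r * ‖component x₀ u n r‖ ^ 2 * Real.sinh r ^ ((N : ℤ) - 3))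
      ((∫ x in hball x₀ R, V (hdist x₀ x) * gradSq u x ∂(vol N))
        - (∫ x in hball x₀ R, V (hdist x₀ x) * radialDeriv x₀ u x ^ 2 ∂(vol N))
        - ((j : ℝ) + 1) * ((N : ℝ) + j - 1) *
          ∫ x in hball x₀ R, V (hdist x₀ x) * u x ^ 2 / Real.sinh (hdist x₀ x) ^ 2 ∂(vol N)) ∧
    ((∀ r ∈ radii R, 0 ≤ V r) →
      ((j : ℝ) + 1) * ((N : ℝ) + j - 1) *
          (∫ x in hball x₀ R, V (hdist x₀ x) * u x ^ 2 / Real.sinh (hdist x₀ x) ^ 2 ∂(vol N)) ≤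
        (∫ x in hball x₀ R, V (hdist x₀ x) * gradSq u x ∂(vol N))
          - ∫ x in hball x₀ R, V (hdist x₀ x) * radialDeriv x₀ u x ^ 2 ∂(vol N)) := by
  obtain ⟨⟨hsm, hcs, hsupp⟩, hcomp⟩ := hu
  lift u to C(Hyp.E N, ℝ) using hsm.continuous
  have hx₀ : x₀ ∉ tsupport u := fun h => (hsupp h).2 rfl
  have hN0 : 0 < N := by omega
  have hK : IsCompact (tsupport u) := hcs
  obtain ⟨hI1, hi1, he1⟩ := integral_hdist_mul hN0 x₀ hV hK hsupp (continuous_gradSq hsm)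
    fun x hx => gradSq_eq_zero hx
  obtain ⟨hI2, hi2, he2⟩ := integral_hdist_mul hN0 x₀ hV hK hsupp
    (G := fun x => radialDeriv x₀ u x ^ 2) ((continuous_radialDeriv hsm hx₀).pow 2)
    fun x hx => by simp [radialDeriv_eq_zero x₀ hx]
  obtain ⟨hI3, hi3, he3⟩ := integral_hdist_mul hN0 x₀ hV hK hsupp
    (continuous_sq_div_sinh_sq hx₀) fun x hx => by simp [image_eq_zero_of_notMem_tsupport hx]
  simp only [← mul_div_assoc] at hI3 he3
  have hcoef : ∀ n : {n : ℕ // j + 1 ≤ (n : ℤ)},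
      0 ≤ ((n : ℝ) - j - 1) * ((N : ℝ) + (n : ℝ) + j - 1) := fun n => by
    have h1 : ((j + 1 : ℤ) : ℝ) ≤ ((n : ℕ) : ℤ) := Int.cast_le.mpr n.2
    have h2 : ((-1 : ℤ) : ℝ) ≤ j := Int.cast_le.mpr hj
    have h3 : ((2 : ℕ) : ℝ) ≤ N := Nat.cast_le.mpr hN
    push_cast at h1 h2 h3
    exact mul_nonneg (by linarith) (by linarith [Nat.cast_nonneg (α := ℝ) (n : ℕ)])
  have hcn : ∀ n : ℕ, IntegrableOn
      (fun r => V r * ‖component x₀ u n r‖ ^ 2 * Real.sinh r ^ ((N : ℤ) - 3)) (radii R) := by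
    intro n
    have hc := continuous_component x₀ u n
    have h := integrableOn_mul_of_continuousOn hV (hK.image (continuous_hdist x₀))
      (hdist_image_subset_radii hsupp)
      (g := fun r => ‖component x₀ u n r‖ ^ 2 * Real.sinh r ^ ((N : ℤ) - 3))
      (ContinuousOn.mul (by fun_prop) (Real.continuous_sinh.continuousOn.zpow₀ _ fun r hr =>
        Or.inl (Real.sinh_pos_iff.mpr hr).ne'))
      (fun r hr hrK => by simp [component, slice_eq_zero hr.1 hrK])
    simpa only [mul_assoc] using h
  -- The integrand on the left-hand side, as a function of the radius.
  set f : ℝ → ℝ := fun r => V r * (((∫ σ, sphereGradSq (sliceFun x₀ u r) σ ∂(sphereMeasure N)) -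
    ((j : ℝ) + 1) * ((N : ℝ) + j - 1) * ∫ σ, u (polar x₀ r σ) ^ 2 ∂(sphereMeasure N)) *
      Real.sinh r ^ ((N : ℤ) - 3)) with hf
  have hfeq : EqOn (fun r => V r * (∫ σ, gradSq u (polar x₀ r σ) ∂(sphereMeasure N)) *
        Real.sinh r ^ (N - 1) -
      V r * (∫ σ, radialDeriv x₀ u (polar x₀ r σ) ^ 2 ∂(sphereMeasure N)) *
        Real.sinh r ^ (N - 1) -
      ((j : ℝ) + 1) * ((N : ℝ) + j - 1) *
        (V r * (∫ σ, u (polar x₀ r σ) ^ 2 / Real.sinh (hdist x₀ (polar x₀ r σ)) ^ 2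
          ∂(sphereMeasure N)) * Real.sinh r ^ (N - 1))) f (radii R) := by
    intro r hr
    have h := integral_gradSq_sub x₀ hsm hx₀ hr.1
    simp only [hdist_polar x₀ hr.1.le, integral_div, hf, ← sinh_pow_div_sq (by omega : 1 ≤ N) hr.1]
    linear_combination (V r * Real.sinh r ^ (N - 1)) * h
  have hfint : IntegrableOn f (radii R) :=
    ((hi1.sub hi2).sub (hi3.const_mul _)).congr_fun hfeq (measurableSet_radii R)
  have hfval : ∫ r in radii R, f r =
      (∫ x in hball x₀ R, V (hdist x₀ x) * gradSq u x ∂(vol N))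
        - (∫ x in hball x₀ R, V (hdist x₀ x) * radialDeriv x₀ u x ^ 2 ∂(vol N))
        - ((j : ℝ) + 1) * ((N : ℝ) + j - 1) *
          ∫ x in hball x₀ R, V (hdist x₀ x) * u x ^ 2 / Real.sinh (hdist x₀ x) ^ 2
            ∂(vol N) := by
    rw [he1, he2, he3, ← setIntegral_congr_fun (measurableSet_radii R) hfeq, integral_sub,
      integral_sub hi1 hi2, integral_const_mul]
    · exact hi1.sub hi2
    · exact hi3.const_mul _
  have hslice : ∀ r ∈ radii R, HasSum (fun n : {n : ℕ // j + 1 ≤ (n : ℤ)} =>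
      ((n : ℝ) - j - 1) * ((N : ℝ) + (n : ℝ) + j - 1) * ‖component x₀ u n r‖ ^ 2 *
        Real.sinh r ^ ((N : ℤ) - 3))
      (((∫ σ, sphereGradSq (sliceFun x₀ u r) σ ∂(sphereMeasure N)) -
        ((j : ℝ) + 1) * ((N : ℝ) + j - 1) * ∫ σ, u (polar x₀ r σ) ^ 2 ∂(sphereMeasure N)) *
        Real.sinh r ^ ((N : ℤ) - 3)) := fun r hr =>
    (hasSum_slice hN x₀ hsm j fun n hn => hcomp n hn r hr.1).mul_right _
  have hnonneg : ∀ r ∈ radii R, ∀ n : {n : ℕ // j + 1 ≤ (n : ℤ)},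
      0 ≤ ((n : ℝ) - j - 1) * ((N : ℝ) + (n : ℝ) + j - 1) * ‖component x₀ u n r‖ ^ 2 *
        Real.sinh r ^ ((N : ℤ) - 3) := fun r hr n =>
    mul_nonneg (mul_nonneg (hcoef n) (sq_nonneg _))
      (zpow_nonneg (Real.sinh_nonneg_iff.mpr hr.1.le) _)
  have hsum : HasSum
      (fun n : {n : ℕ // j + 1 ≤ (n : ℤ)} =>
        ((n : ℝ) - j - 1) * ((N : ℝ) + (n : ℝ) + j - 1) *
          ∫ r in radii R, V r * ‖component x₀ u n r‖ ^ 2 * Real.sinh r ^ ((N : ℤ) - 3))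
      (∫ r in radii R, f r) := by
    simp only [← integral_const_mul]
    have hmem := ae_restrict_mem (μ := volume) (measurableSet_radii R)
    -- All terms have the sign of `V r`, so the sum of their absolute values is `|f r|`.
    refine hasSum_integral_of_dominated_convergence
      (fun n r => |V r| * (((n : ℝ) - j - 1) * ((N : ℝ) + (n : ℝ) + j - 1) *
        ‖component x₀ u n r‖ ^ 2 * Real.sinh r ^ ((N : ℤ) - 3)))
      (fun n => ((hcn n).const_mul _).aestronglyMeasurable) (fun n => ?_) ?_ ?_ ?_
    · filter_upwards [hmem] with r hr
      refine le_of_eq ?_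
      rw [← abs_of_nonneg (hnonneg r hr n), ← abs_mul, Real.norm_eq_abs]
      congr 1
      ring
    · filter_upwards [hmem] with r hr
      exact ((hslice r hr).mul_left _).summable
    · refine (hfint.abs).congr ?_
      filter_upwards [hmem] with r hr
      rw [((hslice r hr).mul_left _).tsum_eq, hf, abs_mul,
        abs_of_nonneg ((hslice r hr).nonneg (hnonneg r hr))]
    · filter_upwards [hmem] with r hr
      refine ((hslice r hr).mul_left (V r)).congr_fun fun n => ?_
      ring
  rw [hfval] at hsum
  refine ⟨hI1, hI2, hI3, hcn, hsum, fun hV0 => ?_⟩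
  have h := hsum.nonneg fun n => mul_nonneg (hcoef n)
    (setIntegral_nonneg (measurableSet_radii R) fun r hr =>
      mul_nonneg (mul_nonneg (hV0 r hr) (sq_nonneg _))
        (zpow_nonneg (Real.sinh_nonneg_iff.mpr hr.1.le) _))
  linarith
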